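/- Let $p\in(0,1)$. For $x>0$ let $m_p(x)>0$ denote the $p$-quantile of the gamma distribution with shape parameter $x$ and scale parameter $1$, i.e. the solution of $$\int_0^{m_p(x)}e^{-t}t^{x-1}\,dt=p\,\Gamma(x),$$ and let $L_p\in\mathbb R$ denote the $(1-p)$-quantile of the standard Gaussian distribution, i.e. the solution of $\int_0^{L_p}e^{-s^2/2}\,ds=(1-2p)\sqrt{\pi/2}$. Then $m_p$ has an asymptotic expansion at infinity in powers of $x^{-1/2}$: there are real numbers $\tau_n=\tau_n(p)$, $n\ge -2$, such that $$m_p(x)\sim\sum_{n=-2}^{\infty}\frac{\tau_n}{x^{n/2}}\qquad (x\to\infty),$$ meaning that for every integer $N\ge -2$ $$m_p(x)-\sum_{n=-2}^{N}\frac{\tau_n}{x^{n/2}}=O\!\left(x^{-(N+1)/2}\right)\qquad (x\to\infty),$$ and the first coefficients are $$\tau_{-2}=1,\qquad \tau_{-1}=-L_p,\qquad \tau_0=\frac{L_p^2-1}{3},\qquad \tau_1=\frac{L_p(7-L_p^2)}{36}.$$ -/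

import Mathlib

open MeasureTheory ProbabilityTheory Filter Topology Set

/-- The `q`-quantile of a probability measure `μ` on `ℝ`: the smallest `y` with
`μ (-∞, y] ≥ q`. -/
noncomputable def quantile (μ : Measure ℝ) (q : ℝ) : ℝ :=
  sInf {y : ℝ | q ≤ cdf μ y}

/-- `m_p(x)`: the `p`-quantile of the gamma distribution of shape parameter `x` and
scale parameter `1`. -/
noncomputable def gammaQuantile (p x : ℝ) : ℝ :=
  quantile (gammaMeasure x 1) p

/-- `L_p`: the `(1 - p)`-quantile of the standard Gaussian distribution. -/
noncomputable def gaussianUpperQuantile (p : ℝ) : ℝ :=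
  quantile (gaussianReal 0 1) (1 - p)

/-- `f(x) ∼ ∑_{n ≥ n₀} τ_n x^{-n/2}` as `x → ∞`, in the sense of Poincaré: for every
`N ≥ n₀`, `f(x) - ∑_{n = n₀}^{N} τ_n x^{-n/2} = O(x^{-(N+1)/2})` as `x → ∞`. -/
def HasHalfPowerExpansion (f : ℝ → ℝ) (n₀ : ℤ) (τ : ℤ → ℝ) : Prop :=
  ∀ N : ℤ, n₀ ≤ N →
    (fun x : ℝ => f x - ∑ n ∈ Finset.Icc n₀ N, τ n * x ^ (-((n : ℝ) / 2)))
      =O[atTop] fun x : ℝ => x ^ (-(((N : ℝ) + 1) / 2))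

/-- For a measure without atoms the quantile solves the equation `cdf μ y = q`. -/
theorem cdf_quantile (μ : Measure ℝ) [IsProbabilityMeasure μ]
    (hμ : ∀ y : ℝ, μ {y} = 0) {q : ℝ} (h0 : 0 < q) (h1 : q < 1) :
    cdf μ (quantile μ q) = q := by
  have hc : Continuous (cdf μ) := by
    rw [continuous_iff_continuousAt]
    intro y
    rw [(monotone_cdf μ).continuousAt_iff_leftLim_eq_rightLim, (cdf μ).rightLim_eq]
    have h := (cdf μ).measure_singleton y
    rw [measure_cdf, hμ] at h
    have h2 := ENNReal.ofReal_eq_zero.1 h.symm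
    have h3 := (monotone_cdf μ).leftLim_le (le_refl y)
    linarith
  have hne : {y : ℝ | q ≤ cdf μ y}.Nonempty := by
    obtain ⟨y, hy⟩ := ((tendsto_cdf_atTop μ).eventually (lt_mem_nhds h1)).exists
    exact ⟨y, hy.le⟩
  have hbdd : BddBelow {y : ℝ | q ≤ cdf μ y} := by
    obtain ⟨z, hz⟩ := ((tendsto_cdf_atBot μ).eventually (gt_mem_nhds h0)).exists
    refine ⟨z, fun y hy => ?_⟩
    by_contra! hlt
    have := monotone_cdf μ hlt.le
    have hy' : q ≤ cdf μ y := hy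
    linarith
  have hcl : IsClosed {y : ℝ | q ≤ cdf μ y} := isClosed_le continuous_const hc
  refine le_antisymm ?_ (hcl.csInf_mem hne hbdd)
  have ht : Tendsto (cdf μ) (𝓝[<] (quantile μ q)) (𝓝 (cdf μ (quantile μ q))) :=
    hc.continuousAt.tendsto.mono_left nhdsWithin_le_nhds
  refine le_of_tendsto ht ?_
  filter_upwards [self_mem_nhdsWithin] with y hy
  by_contra! hlt
  exact absurd (csInf_le hbdd (show y ∈ {y : ℝ | q ≤ cdf μ y} from hlt.le)) (not_le.2 hy)

/-- The implicit equation for `m_p(x)`. -/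
theorem gammaQuantile_spec {p x : ℝ} (h0 : 0 < p) (h1 : p < 1) (hx : 0 < x) :
    0 < gammaQuantile p x ∧
      ∫ t in (0 : ℝ)..gammaQuantile p x, Real.exp (-t) * t ^ (x - 1) = p * Real.Gamma x := by
  have hP := isProbabilityMeasure_gammaMeasure hx one_pos
  have hq : cdf (gammaMeasure x 1) (gammaQuantile p x) = p :=
    cdf_quantile (gammaMeasure x 1)
      (fun y => withDensity_absolutelyContinuous _ _ (measure_singleton y)) h0 h1
  rw [cdf_gammaMeasure_eq_integral hx one_pos] at hq
  have hneg : ∀ y ≤ (0 : ℝ), ∫ t in Iic y, gammaPDFReal x 1 t = 0 := by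
    intro y hy
    rw [integral_Iic_eq_integral_Iio]
    refine setIntegral_eq_zero_of_forall_eq_zero fun t ht => ?_
    have : t < 0 := lt_of_lt_of_le ht hy
    simp [gammaPDFReal, not_le.2 this]
  have hm : 0 < gammaQuantile p x := by
    by_contra! hle
    rw [hneg _ hle] at hq
    exact h0.ne hq
  refine ⟨hm, ?_⟩
  have hint : IntegrableOn (gammaPDFReal x 1) (Iic (gammaQuantile p x)) := by
    by_contra hni
    rw [integral_undef hni] at hq
    exact h0.ne hq
  have hsub := intervalIntegral.integral_Iic_sub_Iic
    (hint.mono_set (Iic_subset_Iic.2 hm.le)) hint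
  rw [hq, hneg 0 le_rfl, sub_zero] at hsub
  have hΓ := (Real.Gamma_pos_of_pos hx).ne'
  refine Eq.trans ?_ (congrArg (· * Real.Gamma x) hsub.symm)
  rw [← intervalIntegral.integral_mul_const]
  refine intervalIntegral.integral_congr fun t ht => ?_
  rw [uIcc_of_le hm.le] at ht
  simp only [gammaPDFReal, if_pos ht.1, Real.one_rpow, one_mul]
  field_simp

/-- The implicit equation for `L_p`. -/
theorem gaussianUpperQuantile_spec {p : ℝ} (h0 : 0 < p) (h1 : p < 1) :
    ∫ s in (0 : ℝ)..gaussianUpperQuantile p, Real.exp (-s ^ 2 / 2)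
      = (1 - 2 * p) * √(Real.pi / 2) := by
  have hq : cdf (gaussianReal 0 1) (gaussianUpperQuantile p) = 1 - p :=
    cdf_quantile _ (fun y => gaussianReal_absolutelyContinuous 0 one_ne_zero
      (measure_singleton y)) (by linarith) (by linarith)
  have hcdf : ∀ y, cdf (gaussianReal 0 1) y = ∫ s in Iic y, gaussianPDFReal 0 1 s := by
    intro y
    rw [cdf_eq_real, measureReal_def, gaussianReal_apply_eq_integral 0 one_ne_zero,
      ENNReal.toReal_ofReal (integral_nonneg fun s => gaussianPDFReal_nonneg 0 1 s)]
  have hint := integrable_gaussianPDFReal 0 1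
  have hhalf : ∫ s in Iic (0 : ℝ), gaussianPDFReal 0 1 s = 1 / 2 := by
    have hs : ∫ s in Iic (0 : ℝ), gaussianPDFReal 0 1 s
        = ∫ s in Ioi (0 : ℝ), gaussianPDFReal 0 1 s := by
      have := integral_comp_neg_Iic (0 : ℝ) (gaussianPDFReal 0 1)
      simpa [gaussianPDFReal] using this
    have ht := intervalIntegral.integral_Iic_add_Ioi (b := (0 : ℝ))
      hint.integrableOn hint.integrableOn
    rw [integral_gaussianPDFReal_eq_one 0 one_ne_zero] at ht
    linarith
  have hsub := intervalIntegral.integral_Iic_sub_Iic (a := 0) (b := gaussianUpperQuantile p)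
    hint.integrableOn hint.integrableOn
  rw [← hcdf, hq, hhalf] at hsub
  have hpdf : ∀ s : ℝ, Real.exp (-s ^ 2 / 2) = √(2 * Real.pi) * gaussianPDFReal 0 1 s := by
    intro s
    have : √(2 * Real.pi) ≠ 0 := by positivity
    simp only [gaussianPDFReal, NNReal.coe_one, mul_one, sub_zero]
    field_simp
  simp_rw [hpdf]
  rw [intervalIntegral.integral_const_mul, ← hsub]
  have h4 : √(2 * Real.pi) = 2 * √(Real.pi / 2) := by
    rw [show 2 * Real.pi = 2 ^ 2 * (Real.pi / 2) by ring, Real.sqrt_mul (by positivity),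
      Real.sqrt_sq (by norm_num)]
  rw [h4]
  ring

/-! Put `x = e⁻²` and `r = e² t`. The gamma integrand becomes a constant times `exp(-φ(r)/e²) dr/r`,
where `φ(r) = r - 1 - log r ≥ 0` has its only zero, a double one, at `r = 1`. Hence `φ = v²/2` for
an increasing smooth coordinate `v = (r - 1) κ(r)` on `(0, ∞)`, and `dr/r = κ dv`. With `y = v/e`
the quantile equation becomes `∫_{-∞}^Y e^{-y²/2} g(e y) dy = p ∫_ℝ e^{-y²/2} g(e y) dy`, where `g =
κ ∘ v⁻¹` is smooth at `0` and `g(0) = 1`.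

Away from `0`, `g` grows at most linearly, so its Taylor polynomial of degree below `K` has error
`O(|y|^K)` on all of `ℝ`. Integration against the Gaussian leaves an equation `F(e, Y) = O(e^K)`,
with `F` a finite sum of smooth truncated moments (`quantileEq_isBigO`). At `e = 0` its solution is
`Y = -L_p`, and `∂F/∂Y` is a Gaussian density value, hence nonzero. The implicit function theorem
gives a smooth exact zero of `F`, and the same nondegeneracy puts the true `Y` within `O(e^K)` of it
(`sub_isBigO_quantileEq_sub`). Since `e² m_p(e⁻²) = v⁻¹(e Y)`, Taylor's formula gives an expansion
in `e` of every order. Uniqueness of coefficients glues these expansions and identifies the first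
four with those of an explicit approximate solution. -/

open scoped ContDiff

/-! ### One-sided asymptotic expansions at `0` -/

/-- Taylor expansion of a smooth function at `0`, with a big-O remainder. -/
theorem ContDiffAt.exists_taylor_isBigO {f : ℝ → ℝ} (hf : ContDiffAt ℝ ∞ f 0) (K : ℕ) :
    ∃ c : ℕ → ℝ, (fun e => f e - ∑ k ∈ Finset.range K, c k * e ^ k) =O[𝓝 0] fun e => e ^ K := by
  obtain ⟨u, hu, hfu⟩ := (hf.of_le (by exact_mod_cast le_top : (K : ℕ∞ω) ≤ ∞)).contDiffOn
    le_rfl (by simp)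
  obtain ⟨δ, hδ, hδu⟩ := Metric.mem_nhds_iff.1 (by simpa using hu : u ∈ 𝓝 (0 : ℝ))
  have hs : Metric.ball (0 : ℝ) δ ∈ 𝓝 (0 : ℝ) := Metric.ball_mem_nhds 0 hδ
  have ht := taylor_isLittleO (convex_ball (0 : ℝ) δ) (Metric.mem_ball_self hδ) (hfu.mono hδu)
  rw [nhdsWithin_eq_nhds.2 hs] at ht
  refine ⟨fun k => ((k.factorial : ℝ)⁻¹ * iteratedDerivWithin k f (Metric.ball 0 δ) 0), ?_⟩
  -- The degree `K` polynomial has error `o(e^K)`; its top term is `O(e^K)` and can be dropped.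
  have h2 : (fun e : ℝ => ((K.factorial : ℝ)⁻¹ * iteratedDerivWithin K f (Metric.ball 0 δ) 0)
      * e ^ K) =O[𝓝 0] fun e => e ^ K := Asymptotics.isBigO_const_mul_self _ _ _
  have h1 := ht.isBigO
  simp only [sub_zero] at h1
  refine (h1.add h2).congr_left fun e => ?_
  rw [taylor_within_apply, Finset.sum_range_succ]
  simp only [sub_zero, smul_eq_mul]
  have : ∀ k : ℕ, (k.factorial : ℝ)⁻¹ * e ^ k * iteratedDerivWithin k f (Metric.ball 0 δ) 0
    = (k.factorial : ℝ)⁻¹ * iteratedDerivWithin k f (Metric.ball 0 δ) 0 * e ^ k := fun k => by ring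
  simp only [this]
  ring

/-- A polynomial of degree less than `K` that is `O(e ^ K)` as `e → 0+` vanishes. -/
theorem eq_zero_of_sum_isBigO_pow {K : ℕ} {c : ℕ → ℝ}
    (h : (fun e : ℝ => ∑ k ∈ Finset.range K, c k * e ^ k) =O[𝓝[>] 0] fun e => e ^ K) :
    ∀ k < K, c k = 0 := by
  induction K generalizing c with
  | zero => simp
  | succ K ih =>
    have ht0 : Tendsto (fun e : ℝ => e ^ (K + 1)) (𝓝[>] 0) (𝓝 0) :=
      (((continuous_pow (M := ℝ) (K + 1)).tendsto' 0 0 (by simp))).mono_left nhdsWithin_le_nhds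
    have ht1 := h.trans_tendsto ht0
    have ht2 : Tendsto (fun e : ℝ => ∑ k ∈ Finset.range (K + 1), c k * e ^ k) (𝓝[>] 0)
        (𝓝 (c 0)) := by
      refine Tendsto.mono_left ?_ nhdsWithin_le_nhds
      refine Continuous.tendsto' (by fun_prop) _ _ ?_
      rw [Finset.sum_range_succ']
      simp
    have hc0 : c 0 = 0 := tendsto_nhds_unique ht2 ht1
    have h' : (fun e : ℝ => ∑ k ∈ Finset.range K, c (k + 1) * e ^ k) =O[𝓝[>] 0]
        fun e => e ^ K := by
      have hinv : (fun e : ℝ => e⁻¹) =O[𝓝[>] 0] fun e => e⁻¹ := Asymptotics.isBigO_refl _ _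
      refine (hinv.mul h).congr' ?_ ?_
      · filter_upwards [self_mem_nhdsWithin] with e (he : 0 < e)
        rw [Finset.sum_range_succ', hc0, zero_mul, add_zero, Finset.mul_sum]
        refine Finset.sum_congr rfl fun k _ => ?_
        field_simp
        ring
      · filter_upwards [self_mem_nhdsWithin] with e (he : 0 < e)
        field_simp
        ring
    intro k hk
    cases k with
    | zero => exact hc0
    | succ k => exact ih h' k (by omega)

theorem isBigO_pow_of_le {l : Filter ℝ} (hl : l ≤ 𝓝 0) {m n : ℕ} (h : m ≤ n) :
    (fun e : ℝ => e ^ n) =O[l] fun e => e ^ m := by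
  refine Asymptotics.IsBigO.of_bound 1 ?_
  filter_upwards [hl (Metric.closedBall_mem_nhds (0 : ℝ) one_pos)] with e he
  have he1 : |e| ≤ 1 := by simpa using he
  rw [one_mul, norm_pow, norm_pow, Real.norm_eq_abs]
  exact pow_le_pow_of_le_one (abs_nonneg e) he1 h

/-- Expansions of lower order are obtained by truncation. -/
theorem isBigO_sub_sum_of_le {f : ℝ → ℝ} {c : ℕ → ℝ} {l : Filter ℝ} (hl : l ≤ 𝓝 0) {J K : ℕ}
    (hJK : J ≤ K)
    (h : (fun e => f e - ∑ k ∈ Finset.range K, c k * e ^ k) =O[l] fun e => e ^ K) :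
    (fun e => f e - ∑ k ∈ Finset.range J, c k * e ^ k) =O[l] fun e => e ^ J := by
  have hp : ∀ i, J ≤ i → (fun e : ℝ => e ^ i) =O[l] fun e => e ^ J := fun i hi =>
    isBigO_pow_of_le hl hi
  have h2 : (fun e : ℝ => ∑ k ∈ Finset.Ico J K, c k * e ^ k) =O[l] fun e => e ^ J :=
    Asymptotics.IsBigO.fun_sum fun i hi =>
      (hp i (Finset.mem_Ico.1 hi).1).const_mul_left _
  refine ((h.trans (hp K hJK)).add h2).congr_left fun e => ?_
  rw [← Finset.sum_range_add_sum_Ico _ hJK]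
  ring

/-- Coefficients of one-sided expansions at `0` are unique. -/
theorem expansion_coeff_unique {f : ℝ → ℝ} {b c : ℕ → ℝ} {K : ℕ}
    (hb : (fun e => f e - ∑ k ∈ Finset.range K, b k * e ^ k) =O[𝓝[>] 0] fun e => e ^ K)
    (hc : (fun e => f e - ∑ k ∈ Finset.range K, c k * e ^ k) =O[𝓝[>] 0] fun e => e ^ K) :
    ∀ k < K, b k = c k := by
  intro k hk
  have := eq_zero_of_sum_isBigO_pow (K := K) (c := fun k => c k - b k)
    ((hb.sub hc).congr_left fun e => by simp [sub_mul]) k hk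
  linarith

/-- Expansions of every finite order glue to a single sequence of coefficients. -/
theorem exists_expansion {f : ℝ → ℝ}
    (h : ∀ K : ℕ, ∃ c : ℕ → ℝ,
      (fun e => f e - ∑ k ∈ Finset.range K, c k * e ^ k) =O[𝓝[>] 0] fun e => e ^ K) :
    ∃ a : ℕ → ℝ, ∀ K : ℕ,
      (fun e => f e - ∑ k ∈ Finset.range K, a k * e ^ k) =O[𝓝[>] 0] fun e => e ^ K := by
  choose c hc using h
  -- The expansion of order `k + 1` is the shortest one that contains `e^k`; by truncation and
  -- uniqueness every longer one has the same coefficient there.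
  refine ⟨fun k => c (k + 1) k, fun K => (hc K).congr_left fun e => ?_⟩
  congr 1
  refine Finset.sum_congr rfl fun k hk => ?_
  rw [expansion_coeff_unique (isBigO_sub_sum_of_le nhdsWithin_le_nhds
    (Finset.mem_range.1 hk : k + 1 ≤ K) (hc K)) (hc (k + 1)) k (Nat.lt_succ_self k)]

/-- If `A` is strictly increasing on an open set, then `A ∘ Y → A z` forces `Y → z`. -/
theorem StrictMonoOn.tendsto_of_tendsto_comp {α : Type*} {l : Filter α} {A : ℝ → ℝ} {s : Set ℝ}
    (hA : StrictMonoOn A s) (hs : IsOpen s) {Y : α → ℝ} {z : ℝ} (hz : z ∈ s)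
    (hY : ∀ᶠ e in l, Y e ∈ s) (h : Tendsto (fun e => A (Y e)) l (𝓝 (A z))) :
    Tendsto Y l (𝓝 z) := by
  obtain ⟨δ, hδ, hδs⟩ := Metric.isOpen_iff.1 hs z hz
  refine tendsto_order.2 ⟨fun a ha => ?_, fun b hb => ?_⟩
  · have hm : max a (z - δ / 2) ∈ s := hδs (by
      have h1 : max a (z - δ / 2) < z := max_lt ha (by linarith)
      have h2 := le_max_right a (z - δ / 2)
      rw [Metric.mem_ball, Real.dist_eq, abs_lt]; constructor <;> linarith)
    have hlt : max a (z - δ / 2) < z := max_lt ha (by linarith)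
    filter_upwards [hY, h.eventually (lt_mem_nhds (hA hm hz hlt))] with e he h1
    exact (le_max_left _ _).trans_lt ((hA.lt_iff_lt hm he).1 h1)
  · have hm : min b (z + δ / 2) ∈ s := hδs (by
      have h1 : z < min b (z + δ / 2) := lt_min hb (by linarith)
      have h2 := min_le_right b (z + δ / 2)
      rw [Metric.mem_ball, Real.dist_eq, abs_lt]; constructor <;> linarith)
    have hlt : z < min b (z + δ / 2) := lt_min hb (by linarith)
    filter_upwards [hY, h.eventually (gt_mem_nhds (hA hz hm hlt))] with e he h1
    exact ((hA.lt_iff_lt he hm).1 h1).trans_le (min_le_left _ _)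

/-- A function with `g 0 = 0` whose derivative is `O(t ^ n)` is `O(t ^ (n + 1))`. -/
theorem isBigO_pow_succ_of_hasDerivAt {g g' : ℝ → ℝ} {n : ℕ} (h0 : g 0 = 0)
    (hd : ∀ᶠ t in 𝓝 0, HasDerivAt g (g' t) t) (hO : g' =O[𝓝 0] fun t => t ^ n) :
    g =O[𝓝 0] fun t => t ^ (n + 1) := by
  obtain ⟨C, hC0, hC⟩ := hO.exists_nonneg
  obtain ⟨δ, hδ, hb⟩ := Metric.eventually_nhds_iff_ball.1 (hd.and hC.bound)
  refine Asymptotics.IsBigO.of_bound C ?_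
  filter_upwards [Metric.ball_mem_nhds 0 hδ] with t ht
  have hsub : ∀ x ∈ Metric.closedBall (0 : ℝ) |t|, x ∈ Metric.ball (0 : ℝ) δ := fun x hx => by
    rw [Metric.mem_ball, Real.dist_eq, sub_zero] at ht ⊢
    rw [Metric.mem_closedBall, Real.dist_eq, sub_zero] at hx
    exact hx.trans_lt ht
  have := (convex_closedBall (0 : ℝ) |t|).norm_image_sub_le_of_norm_hasDerivWithin_le
    (f := g) (f' := g') (C := C * |t| ^ n) (x := 0) (y := t)
    (fun x hx => (hb x (hsub x hx)).1.hasDerivWithinAt)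
    (fun x hx => by
      refine (hb x (hsub x hx)).2.trans ?_
      rw [norm_pow, Real.norm_eq_abs]
      have : |x| ≤ |t| := by simpa using hx
      gcongr)
    (by simp) (by simp)
  rw [h0, sub_zero, sub_zero] at this
  rw [norm_pow, Real.norm_eq_abs t, pow_succ, ← mul_assoc]
  simpa using this

/-- One may cancel a factor of exact order `t`. -/
theorem isBigO_pow_of_mul_isBigO_pow_succ {f g : ℝ → ℝ} {n : ℕ}
    (hfg : (fun t => f t * g t) =O[𝓝[>] 0] fun t => t ^ (n + 1))
    (hg : (fun t => t) =O[𝓝[>] 0] g) : f =O[𝓝[>] 0] fun t => t ^ n := by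
  have h1 : (fun t => f t * t) =O[𝓝[>] 0] fun t => t ^ (n + 1) :=
    ((Asymptotics.isBigO_refl f _).mul hg).trans hfg
  refine (h1.mul (Asymptotics.isBigO_refl (fun t : ℝ => t⁻¹) _)).congr' ?_ ?_
  · filter_upwards [self_mem_nhdsWithin] with t (ht : 0 < t)
    field_simp
  · filter_upwards [self_mem_nhdsWithin] with t (ht : 0 < t)
    field_simp
    ring

theorem AnalyticAt.dslope {f : ℝ → ℝ} {a : ℝ} (hf : AnalyticAt ℝ f a) :
    AnalyticAt ℝ (dslope f a) a := by
  obtain ⟨p, hp⟩ := hf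
  exact ⟨_, hp.has_fpower_series_dslope_fslope⟩

/-! ### The phase, the Gaussian coordinate and its inverse -/

/-- The phase `r - 1 - log r` of the gamma integral. -/
noncomputable def gammaPhase (r : ℝ) : ℝ := r - 1 - Real.log r

/-- The quotient `(r - 1 - log r) / (r - 1) ^ 2`, extended analytically to `r = 1`. -/
noncomputable def gammaPhaseQuot : ℝ → ℝ := dslope (dslope gammaPhase 1) 1

theorem hasDerivAt_gammaPhase {r : ℝ} (hr : 0 < r) : HasDerivAt gammaPhase (1 - r⁻¹) r := by
  have := ((hasDerivAt_id r).sub_const 1).sub (Real.hasDerivAt_log hr.ne')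
  exact this

theorem analyticAt_gammaPhase {r : ℝ} (hr : 0 < r) : AnalyticAt ℝ gammaPhase r :=
  (analyticAt_id.sub analyticAt_const).sub (analyticAt_log hr)

theorem gammaPhase_pos {r : ℝ} (hr : 0 < r) (h1 : r ≠ 1) : 0 < gammaPhase r := by
  have := Real.log_lt_sub_one_of_pos hr h1
  unfold gammaPhase
  linarith

theorem gammaPhaseQuot_of_ne {r : ℝ} (h1 : r ≠ 1) :
    gammaPhaseQuot r = gammaPhase r / (r - 1) ^ 2 := by
  -- The phase is critical at `1`, so the second slope has nothing to subtract.
  have h0 : dslope gammaPhase 1 1 = 0 := by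
    rw [dslope_same, (hasDerivAt_gammaPhase one_pos).deriv]
    simp
  have : r - 1 ≠ 0 := sub_ne_zero.2 h1
  rw [gammaPhaseQuot, dslope_of_ne _ h1, slope_def_field, h0, dslope_of_ne _ h1, slope_def_field]
  simp only [gammaPhase, Real.log_one, sub_self, sub_zero]
  field_simp

theorem analyticAt_gammaPhaseQuot {r : ℝ} (hr : 0 < r) : AnalyticAt ℝ gammaPhaseQuot r := by
  rcases eq_or_ne r 1 with rfl | h1
  · exact (analyticAt_gammaPhase one_pos).dslope.dslope
  · have : AnalyticAt ℝ (fun r => gammaPhase r / (r - 1) ^ 2) r :=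
      (analyticAt_gammaPhase hr).div ((analyticAt_id.sub analyticAt_const).pow 2)
        (pow_ne_zero 2 (sub_ne_zero.2 h1))
    refine this.congr ?_
    filter_upwards [isOpen_ne.mem_nhds h1] with s hs
    exact (gammaPhaseQuot_of_ne hs).symm

theorem gammaPhaseQuot_one : gammaPhaseQuot 1 = 1 / 2 := by
  have h1 : Tendsto gammaPhaseQuot (𝓝[≠] 1) (𝓝 (gammaPhaseQuot 1)) :=
    (analyticAt_gammaPhaseQuot one_pos).continuousAt.tendsto.mono_left nhdsWithin_le_nhds
  refine tendsto_nhds_unique h1 (tendsto_iff_norm_sub_tendsto_zero.2 ?_)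
  -- This is the tail bound `|s|³ / (1 - |s|)` for the series of `log (1 - s)` after two terms, at
  -- `s = 1 - r`, divided by `s²`.
  have h2 : Tendsto (fun r : ℝ => |1 - r| / (1 - |1 - r|)) (𝓝[≠] 1) (𝓝 0) := by
    have : ContinuousAt (fun r : ℝ => |1 - r| / (1 - |1 - r|)) 1 :=
      ContinuousAt.div (by fun_prop) (by fun_prop) (by simp)
    simpa [ContinuousAt] using this.tendsto.mono_left (nhdsWithin_le_nhds (s := {1}ᶜ))
  refine squeeze_zero' (Eventually.of_forall fun r => norm_nonneg _) ?_ h2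
  filter_upwards [self_mem_nhdsWithin, nhdsWithin_le_nhds (Metric.ball_mem_nhds 1 one_pos)]
    with r hr hr1
  have hr1' : |1 - r| < 1 := by rwa [Metric.mem_ball, Real.dist_eq, abs_sub_comm] at hr1
  have hpos : 0 < |1 - r| := abs_pos.2 (sub_ne_zero.2 (Ne.symm hr))
  have h3 := Real.abs_log_sub_add_sum_range_le hr1' 2
  simp only [Finset.sum_range_succ, Finset.sum_range_zero] at h3
  have h4 : gammaPhaseQuot r - 1 / 2 =
      -((0 + (1 - r) ^ (0 + 1) / (((0 : ℕ) : ℝ) + 1) + (1 - r) ^ (1 + 1) / (((1 : ℕ) : ℝ) + 1)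
        + Real.log (1 - (1 - r))) / (1 - r) ^ 2) := by
    have hne : 1 - r ≠ 0 := abs_pos.1 hpos
    have hne' : r - 1 ≠ 0 := sub_ne_zero.2 hr
    rw [gammaPhaseQuot_of_ne hr, gammaPhase, show (r - 1) ^ 2 = (1 - r) ^ 2 by ring]
    field_simp
    push_cast
    ring_nf
  rw [h4, norm_neg, norm_div, norm_pow, Real.norm_eq_abs, Real.norm_eq_abs,
    div_le_iff₀ (by positivity)]
  refine h3.trans (le_of_eq ?_)
  ring

theorem gammaPhaseQuot_pos {r : ℝ} (hr : 0 < r) : 0 < gammaPhaseQuot r := by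
  rcases eq_or_ne r 1 with rfl | h1
  · rw [gammaPhaseQuot_one]; norm_num
  · rw [gammaPhaseQuot_of_ne h1]
    have : r - 1 ≠ 0 := sub_ne_zero.2 h1
    have := gammaPhase_pos hr h1
    positivity

/-- The slope `v(r) / (r - 1)` of the Gaussian coordinate `v`. -/
noncomputable def gammaSlope (r : ℝ) : ℝ := √(2 * gammaPhaseQuot r)

/-- The Gaussian coordinate `v`: the increasing function with `v(r) ^ 2 / 2 = r - 1 - log r`. -/
noncomputable def gammaCoord (r : ℝ) : ℝ := (r - 1) * gammaSlope r

theorem gammaSlope_pos {r : ℝ} (hr : 0 < r) : 0 < gammaSlope r :=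
  Real.sqrt_pos.2 (mul_pos two_pos (gammaPhaseQuot_pos hr))

theorem gammaSlope_one : gammaSlope 1 = 1 := by
  simp [gammaSlope, gammaPhaseQuot_one]

theorem gammaCoord_one : gammaCoord 1 = 0 := by simp [gammaCoord]

theorem contDiffAt_gammaSlope {r : ℝ} (hr : 0 < r) : ContDiffAt ℝ ∞ gammaSlope r :=
  (contDiffAt_const.mul (analyticAt_gammaPhaseQuot hr).contDiffAt).sqrt
    (mul_pos two_pos (gammaPhaseQuot_pos hr)).ne'

theorem contDiffAt_gammaCoord {r : ℝ} (hr : 0 < r) : ContDiffAt ℝ ∞ gammaCoord r :=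
  (contDiffAt_id.sub contDiffAt_const).mul (contDiffAt_gammaSlope hr)

theorem gammaCoord_sq {r : ℝ} (hr : 0 < r) : gammaCoord r ^ 2 = 2 * gammaPhase r := by
  rw [gammaCoord, mul_pow, gammaSlope, Real.sq_sqrt (mul_pos two_pos (gammaPhaseQuot_pos hr)).le]
  rcases eq_or_ne r 1 with rfl | h1
  · simp [gammaPhase]
  · have : r - 1 ≠ 0 := sub_ne_zero.2 h1
    rw [gammaPhaseQuot_of_ne h1]
    field_simp

/-- Differentiating `v² = 2φ` gives `v v' = (r - 1)/r`, and `v = (r - 1) κ` cancels the factor `r -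
1`. At `r = 1` this division is impossible and the product rule is used instead. -/
theorem hasDerivAt_gammaCoord {r : ℝ} (hr : 0 < r) :
    HasDerivAt gammaCoord (r * gammaSlope r)⁻¹ r := by
  have hκ := gammaSlope_pos hr
  have hd : HasDerivAt gammaCoord (deriv gammaCoord r) r :=
    ((contDiffAt_gammaCoord hr).differentiableAt (by simp)).hasDerivAt
  convert hd using 1
  rcases eq_or_ne r 1 with rfl | h1
  · have := ((hasDerivAt_id (1 : ℝ)).sub_const 1).mul
      ((contDiffAt_gammaSlope one_pos).differentiableAt (by simp)).hasDerivAt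
    have h2 : HasDerivAt gammaCoord _ 1 := this
    rw [h2.deriv]
    simp [gammaSlope_one]
  · have h2 : HasDerivAt (fun s => gammaCoord s ^ 2) (2 * (1 - r⁻¹)) r := by
      refine ((hasDerivAt_gammaPhase hr).const_mul 2).congr_of_eventuallyEq ?_
      filter_upwards [lt_mem_nhds hr] with s hs using gammaCoord_sq hs
    have h3 := (hd.pow 2).unique h2
    have h4 : r - 1 ≠ 0 := sub_ne_zero.2 h1
    have h5 : gammaCoord r ≠ 0 := mul_ne_zero h4 hκ.ne'
    simp only [Nat.cast_ofNat, Nat.add_one_sub_one, pow_one] at h3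
    have h6 : gammaCoord r * deriv gammaCoord r = 1 - r⁻¹ := by linarith
    refine mul_left_cancel₀ h5 (Eq.trans ?_ h6.symm)
    rw [gammaCoord]
    field_simp

theorem strictMonoOn_gammaCoord : StrictMonoOn gammaCoord (Ioi 0) := by
  refine strictMonoOn_of_deriv_pos (convex_Ioi 0) (fun r hr =>
    (hasDerivAt_gammaCoord hr).continuousAt.continuousWithinAt) fun r hr => ?_
  rw [interior_Ioi] at hr
  have hr0 : 0 < r := hr
  rw [(hasDerivAt_gammaCoord hr0).deriv]
  have := gammaSlope_pos hr0
  positivity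

/-- Intermediate values: `φ(exp(-(y²/2 + 1))) > y²/2` on the negative side and `φ(exp |y|) ≥ y²/2`
on the positive side, so `v` passes below and above `y`. -/
theorem surjOn_gammaCoord : SurjOn gammaCoord (Ioi 0) univ := by
  intro y _
  have ha : gammaCoord (Real.exp (-(y ^ 2 / 2 + 1))) ≤ y := by
    have h1 := gammaCoord_sq (Real.exp_pos (-(y ^ 2 / 2 + 1)))
    rw [gammaPhase, Real.log_exp] at h1
    have h2 : gammaCoord (Real.exp (-(y ^ 2 / 2 + 1))) ≤ 0 :=
      mul_nonpos_of_nonpos_of_nonneg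
        (sub_nonpos.2 (Real.exp_le_one_iff.2 (by nlinarith [sq_nonneg y])))
        (gammaSlope_pos (Real.exp_pos _)).le
    have h3 := Real.exp_pos (-(y ^ 2 / 2 + 1))
    nlinarith
  have hb : y ≤ gammaCoord (Real.exp |y|) := by
    have h1 := gammaCoord_sq (Real.exp_pos |y|)
    rw [gammaPhase, Real.log_exp] at h1
    have h2 : 0 ≤ gammaCoord (Real.exp |y|) :=
      mul_nonneg (sub_nonneg.2 (Real.one_le_exp (abs_nonneg y)))
        (gammaSlope_pos (Real.exp_pos _)).le
    have h3 := Real.quadratic_le_exp_of_nonneg (abs_nonneg y)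
    rw [sq_abs] at h3
    nlinarith
  have hc : ContinuousOn gammaCoord (Ioi 0) := fun r hr =>
    (hasDerivAt_gammaCoord hr).continuousAt.continuousWithinAt
  exact (isPreconnected_Ioi (a := (0 : ℝ))).intermediate_value (Real.exp_pos _) (Real.exp_pos _)
    hc ⟨ha, hb⟩

/-- The inverse of `gammaCoord` on `(0, ∞)`. -/
noncomputable def gammaCoordInv (y : ℝ) : ℝ := Function.invFunOn gammaCoord (Ioi 0) y

theorem gammaCoordInv_pos (y : ℝ) : 0 < gammaCoordInv y :=
  Function.invFunOn_mem (surjOn_gammaCoord (mem_univ y))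

theorem gammaCoord_gammaCoordInv (y : ℝ) : gammaCoord (gammaCoordInv y) = y :=
  Function.invFunOn_eq (surjOn_gammaCoord (mem_univ y))

theorem gammaCoordInv_gammaCoord {r : ℝ} (hr : 0 < r) : gammaCoordInv (gammaCoord r) = r :=
  strictMonoOn_gammaCoord.injOn (gammaCoordInv_pos _) hr (gammaCoord_gammaCoordInv _)

theorem gammaCoordInv_zero : gammaCoordInv 0 = 1 := by
  rw [← gammaCoord_one, gammaCoordInv_gammaCoord one_pos]

theorem strictMono_gammaCoordInv : StrictMono gammaCoordInv := fun a b hab => by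
  rw [← gammaCoord_gammaCoordInv a, ← gammaCoord_gammaCoordInv b] at hab
  exact (strictMonoOn_gammaCoord.lt_iff_lt (gammaCoordInv_pos a) (gammaCoordInv_pos b)).1 hab

/-- The inverse function theorem applies since `v'(1) = 1`. Its local inverse is positive near `0`,
so injectivity of `v` on `(0, ∞)` identifies it with the global inverse. -/
theorem contDiffAt_gammaCoordInv : ContDiffAt ℝ ∞ gammaCoordInv 0 := by
  have hd : HasDerivAt gammaCoord 1 1 := by
    simpa [gammaSlope_one] using hasDerivAt_gammaCoord one_pos
  have hf := contDiffAt_gammaCoord one_pos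
  have hf' : HasFDerivAt gammaCoord
      ((ContinuousLinearEquiv.unitsEquivAut ℝ (1 : ℝˣ) : ℝ ≃L[ℝ] ℝ) : ℝ →L[ℝ] ℝ) 1 :=
    hd.hasFDerivAt.congr_fderiv (by ext; simp)
  have hn : (∞ : ℕ∞ω) ≠ 0 := by simp
  have hg := hf.to_localInverse hf' hn
  rw [gammaCoord_one] at hg
  refine hg.congr_of_eventuallyEq ?_
  have h1 : hf.localInverse hf' hn 0 = 1 := by
    have := hf.localInverse_apply_image hf' hn
    rwa [gammaCoord_one] at this
  have h2 : ∀ᶠ y in 𝓝 (0 : ℝ), 0 < hf.localInverse hf' hn y :=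
    hg.continuousAt.eventually (by rw [h1]; exact lt_mem_nhds one_pos)
  have h3 : ∀ᶠ y in 𝓝 (0 : ℝ), gammaCoord (hf.localInverse hf' hn y) = y := by
    have := (hf.hasStrictFDerivAt' hf' hn).eventually_right_inverse
    rwa [gammaCoord_one] at this
  filter_upwards [h2, h3] with y hy hy'
  conv_lhs => rw [← hy', gammaCoordInv_gammaCoord hy]

/-! ### The density in the Gaussian coordinate and its global Taylor bound -/

/-- The density of the gamma integral in the Gaussian coordinate. -/
noncomputable def gammaDensity (y : ℝ) : ℝ := gammaSlope (gammaCoordInv y)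

theorem gammaDensity_pos (y : ℝ) : 0 < gammaDensity y := gammaSlope_pos (gammaCoordInv_pos y)

theorem sub_one_mul_gammaDensity (y : ℝ) : (gammaCoordInv y - 1) * gammaDensity y = y :=
  gammaCoord_gammaCoordInv y

theorem contDiffAt_gammaDensity : ContDiffAt ℝ ∞ gammaDensity 0 := by
  refine ContDiffAt.comp (g := gammaSlope) (f := gammaCoordInv) 0 ?_ contDiffAt_gammaCoordInv
  exact contDiffAt_gammaSlope (gammaCoordInv_pos 0)

/-- Away from `0` the density grows at most linearly. -/
theorem exists_gammaDensity_le {δ : ℝ} (hδ : 0 < δ) :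
    ∃ C : ℝ, 0 ≤ C ∧ ∀ y, δ ≤ |y| → gammaDensity y ≤ C * |y| := by
  have h1 : 1 < gammaCoordInv δ := by
    rw [← gammaCoordInv_zero]; exact strictMono_gammaCoordInv hδ
  have h0 : gammaCoordInv (-δ) < 1 := by
    rw [← gammaCoordInv_zero]; exact strictMono_gammaCoordInv (neg_lt_zero.2 hδ)
  -- By monotonicity `v⁻¹(y)` stays at distance at least `d` from `1` once `|y| ≥ δ`, and the
  -- density is `|y| / |v⁻¹(y) - 1|`.
  set d := min (gammaCoordInv δ - 1) (1 - gammaCoordInv (-δ)) with hd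
  have hdpos : 0 < d := lt_min (by linarith) (by linarith)
  refine ⟨d⁻¹, (inv_pos.2 hdpos).le, fun y hy => ?_⟩
  have hdist : d ≤ |gammaCoordInv y - 1| := by
    rcases le_abs.1 hy with h | h
    · have := strictMono_gammaCoordInv.monotone h
      exact (min_le_left _ _).trans ((by linarith : _ ≤ gammaCoordInv y - 1).trans (le_abs_self _))
    · have := strictMono_gammaCoordInv.monotone (by linarith : y ≤ -δ)
      exact (min_le_right _ _).trans
        ((by linarith : _ ≤ -(gammaCoordInv y - 1)).trans (neg_le_abs _))
  have h2 := congrArg abs (sub_one_mul_gammaDensity y)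
  rw [abs_mul, abs_of_pos (gammaDensity_pos y)] at h2
  rw [← h2, inv_mul_eq_div, le_div_iff₀ hdpos, mul_comm]
  exact mul_le_mul_of_nonneg_right hdist (gammaDensity_pos y).le

/-- The Taylor expansion of the density has a remainder bound on the whole line. -/
theorem gammaDensity_taylor_bound {K : ℕ} (hK : 1 ≤ K) {h : ℕ → ℝ}
    (hh : (fun y => gammaDensity y - ∑ k ∈ Finset.range K, h k * y ^ k) =O[𝓝 0] fun y => y ^ K) :
    ∃ C : ℝ, 0 ≤ C ∧ ∀ y, |gammaDensity y - ∑ k ∈ Finset.range K, h k * y ^ k| ≤ C * |y| ^ K := by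
  obtain ⟨C₀, hC₀, hb⟩ := hh.exists_nonneg
  obtain ⟨δ, hδ, hball⟩ := Metric.eventually_nhds_iff_ball.1 hb.bound
  obtain ⟨C₁, hC₁, hfar⟩ := exists_gammaDensity_le hδ
  -- Away from `0` all powers up to `K` are dominated by `|y|^K`; as `1 ≤ K`, this absorbs the
  -- linear growth of the density too.
  have hpow : ∀ k ≤ K, ∀ y : ℝ, δ ≤ |y| → |y| ^ k ≤ |y| ^ K / δ ^ (K - k) := fun k hk y hy => by
    rw [le_div_iff₀ (by positivity), ← Nat.add_sub_cancel' hk, pow_add, Nat.add_sub_cancel' hk]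
    gcongr
  refine ⟨C₀ + (C₁ / δ ^ (K - 1) + ∑ k ∈ Finset.range K, |h k| / δ ^ (K - k)),
    by positivity, fun y => ?_⟩
  rw [add_mul]
  have hS : 0 ≤ C₁ / δ ^ (K - 1) + ∑ k ∈ Finset.range K, |h k| / δ ^ (K - k) := by positivity
  rcases lt_or_ge |y| δ with hy | hy
  · have := hball y (by simpa using hy)
    rw [norm_pow, Real.norm_eq_abs, Real.norm_eq_abs] at this
    have h2 : 0 ≤ |y| ^ K := by positivity
    nlinarith [mul_nonneg hS h2]
  · refine le_trans ?_ (le_add_of_nonneg_left (by positivity))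
    refine (abs_sub _ _).trans ?_
    rw [add_mul, Finset.sum_mul]
    refine add_le_add ?_ ?_
    · rw [abs_of_pos (gammaDensity_pos y)]
      refine (hfar y hy).trans ?_
      have := mul_le_mul_of_nonneg_left (hpow 1 hK y hy) hC₁
      rw [pow_one] at this
      exact this.trans (le_of_eq (by ring))
    · refine (Finset.abs_sum_le_sum_abs _ _).trans (Finset.sum_le_sum fun k hk => ?_)
      rw [abs_mul, abs_pow]
      have := mul_le_mul_of_nonneg_left (hpow k (Finset.mem_range.1 hk).le y hy) (abs_nonneg (h k))
      exact this.trans (le_of_eq (by ring))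

/-! ### Explicit low-order expansions of the inverse coordinate and the density -/

/-- The inverse of `gammaCoord` up to fourth order. -/
theorem gammaCoordInv_expansion :
    (fun t => gammaCoordInv t - (1 + t + t ^ 2 / 3 + t ^ 3 / 36)) =O[𝓝[>] 0] fun t => t ^ 4 := by
  set P : ℝ → ℝ := fun t => 1 + t + t ^ 2 / 3 + t ^ 3 / 36 with hP
  have hP0 : P 0 = 1 := by simp [hP]
  have hPd : ∀ t, HasDerivAt P (1 + 2 * t / 3 + t ^ 2 / 12) t := fun t => by
    have := (((hasDerivAt_const t (1 : ℝ)).add (hasDerivAt_id t)).add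
      ((hasDerivAt_pow 2 t).div_const 3)).add ((hasDerivAt_pow 3 t).div_const 36)
    refine this.congr_deriv ?_
    push_cast
    ring
  have hPc : ContinuousAt P 0 := (hPd 0).continuousAt
  have hPpos : ∀ᶠ t in 𝓝 0, 0 < P t := hPc.eventually (by rw [hP0]; exact lt_mem_nhds one_pos)
  -- The derivative is `((P - 1) P' - t P) / P`; the coefficients of `P` cancel its numerator below
  -- `t⁴`.
  have hphase : (fun t => gammaPhase (P t) - t ^ 2 / 2) =O[𝓝 0] fun t => t ^ 5 := by
    refine isBigO_pow_succ_of_hasDerivAt (g' := fun t => t ^ 4 * ((1 / 54 + t / 432) / P t))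
      (by simp [hP0, gammaPhase]) ?_ ?_
    · filter_upwards [hPpos] with t ht
      have := ((hasDerivAt_gammaPhase ht).comp t (hPd t)).sub ((hasDerivAt_pow 2 t).div_const 2)
      refine this.congr_deriv ?_
      have hne := ht.ne'
      field_simp
      simp only [hP]
      push_cast
      ring
    · have hc : ContinuousAt (fun t => (1 / 54 + t / 432) / P t) 0 :=
        ContinuousAt.div (by fun_prop) hPc (by rw [hP0]; norm_num)
      have := (Asymptotics.isBigO_refl (fun t : ℝ => t ^ 4) (𝓝 0)).mul
        (hc.tendsto.isBigO_one ℝ)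
      simpa using this
  have hv : HasDerivAt (fun t => gammaCoord (P t)) 1 0 := by
    have h1 : HasDerivAt gammaCoord 1 (P 0) := by
      rw [hP0]; simpa [gammaSlope_one] using hasDerivAt_gammaCoord one_pos
    have := h1.comp (0 : ℝ) (hPd 0)
    refine this.congr_deriv (by norm_num)
  have hv0 : gammaCoord (P 0) = 0 := by rw [hP0, gammaCoord_one]
  have hsum : (fun t => t) =O[𝓝[>] 0] fun t => gammaCoord (P t) + t := by
    refine Asymptotics.IsBigO.of_bound 1 ?_
    filter_upwards [self_mem_nhdsWithin] with t (ht : 0 < t)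
    have h1 : 1 ≤ P t := by
      have : 0 ≤ t + t ^ 2 / 3 + t ^ 3 / 36 := by positivity
      simp only [hP]
      linarith
    have h2 : 0 ≤ gammaCoord (P t) :=
      mul_nonneg (sub_nonneg.2 h1) (gammaSlope_pos (one_pos.trans_le h1)).le
    rw [Real.norm_of_nonneg ht.le, Real.norm_of_nonneg (by positivity)]
    linarith
  -- Factor `v² - t² = (v - t)(v + t)` with `v = v(P t)`; for `t > 0` the second factor is at least
  -- `t`, so one order is lost.
  have hdiff : (fun t => gammaCoord (P t) - t) =O[𝓝[>] 0] fun t => t ^ 4 := by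
    refine isBigO_pow_of_mul_isBigO_pow_succ (g := fun t => gammaCoord (P t) + t) ?_ hsum
    refine ((hphase.const_mul_left 2).mono nhdsWithin_le_nhds).congr' ?_ EventuallyEq.rfl
    filter_upwards [nhdsWithin_le_nhds hPpos] with t ht
    have := gammaCoord_sq ht
    nlinarith
  have hlip : (fun t => gammaCoordInv (gammaCoord (P t)) - gammaCoordInv t) =O[𝓝[>] 0]
      fun t => gammaCoord (P t) - t := by
    have hs := contDiffAt_gammaCoordInv.hasStrictDerivAt (by simp)
    have ht : Tendsto (fun t => (gammaCoord (P t), t)) (𝓝[>] 0) (𝓝 (0, 0)) := by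
      have : Tendsto (fun t => (gammaCoord (P t), t)) (𝓝 0) (𝓝 (gammaCoord (P 0), 0)) :=
        hv.continuousAt.tendsto.prodMk_nhds tendsto_id
      rw [hv0] at this
      exact this.mono_left nhdsWithin_le_nhds
    exact hs.hasStrictFDerivAt.isBigO_sub.comp_tendsto ht
  refine ((hlip.trans hdiff).neg_left).congr' ?_ EventuallyEq.rfl
  filter_upwards [nhdsWithin_le_nhds hPpos] with t ht
  rw [gammaCoordInv_gammaCoord ht]
  ring

/-- The density up to third order. -/
theorem gammaDensity_expansion :
    (fun t => gammaDensity t - (1 - t / 3 + t ^ 2 / 12)) =O[𝓝[>] 0] fun t => t ^ 3 := by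
  have hs : (fun t => t) =O[𝓝[>] 0] fun t => gammaCoordInv t - 1 := by
    have : gammaDensity =O[𝓝[>] 0] fun _ => (1 : ℝ) :=
      ((contDiffAt_gammaDensity.continuousAt.tendsto).isBigO_one ℝ).mono nhdsWithin_le_nhds
    refine ((Asymptotics.isBigO_refl (fun t => gammaCoordInv t - 1) _).mul this).congr ?_ ?_
    · exact sub_one_mul_gammaDensity
    · simp
  refine isBigO_pow_of_mul_isBigO_pow_succ (g := fun t => gammaCoordInv t - 1) ?_ hs
  have hQ : (fun t : ℝ => 1 - t / 3 + t ^ 2 / 12) =O[𝓝[>] 0] fun _ => (1 : ℝ) :=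
    ((Continuous.tendsto (by fun_prop) (0 : ℝ)).isBigO_one ℝ).mono nhdsWithin_le_nhds
  have h1 := (hQ.mul gammaCoordInv_expansion)
  -- With `P` the cubic for `v⁻¹` and `Q` the claimed quadratic, this function is exactly `(P - 1) Q
  -- - t`.
  have h2 : (fun t : ℝ => t ^ 4 * (1 / 54 + t / 432)) =O[𝓝[>] 0] fun t => t ^ 4 := by
    have hc : (fun t : ℝ => 1 / 54 + t / 432) =O[𝓝[>] 0] fun _ => (1 : ℝ) :=
      ((Continuous.tendsto (by fun_prop) (0 : ℝ)).isBigO_one ℝ).mono nhdsWithin_le_nhds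
    simpa using (Asymptotics.isBigO_refl (fun t : ℝ => t ^ 4) _).mul hc
  simp only [one_mul] at h1
  refine (h1.neg_left.sub h2).congr_left fun t => ?_
  have := sub_one_mul_gammaDensity t
  linear_combination -this

/-! ### From the gamma integral to a perturbed Gaussian integral -/

/-- The map `t ↦ v(e² t) / e` on `(0, ∞)`, taking the gamma integrand of shape `e⁻²` to a
perturbed Gaussian. -/
noncomputable def gammaToGauss (e t : ℝ) : ℝ := gammaCoord (e ^ 2 * t) / e

/-- The perturbed Gaussian integrand. -/
noncomputable def perturbedGaussian (e y : ℝ) : ℝ := Real.exp (-y ^ 2 / 2) * gammaDensity (e * y)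

theorem hasDerivAt_gammaToGauss {e t : ℝ} (he : 0 < e) (ht : 0 < t) :
    HasDerivAt (gammaToGauss e) ((e * t * gammaSlope (e ^ 2 * t))⁻¹) t := by
  have h0 : 0 < e ^ 2 * t := by positivity
  have hs := gammaSlope_pos h0
  have h1 : HasDerivAt (fun t => e ^ 2 * t) (e ^ 2) t := by
    simpa using (hasDerivAt_id t).const_mul (e ^ 2)
  refine (((hasDerivAt_gammaCoord h0).comp t h1).div_const e).congr_deriv ?_
  field_simp

theorem strictMonoOn_gammaToGauss {e : ℝ} (he : 0 < e) : StrictMonoOn (gammaToGauss e) (Ioi 0) :=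
  fun a (ha : 0 < a) b (hb : 0 < b) hab => by
    unfold gammaToGauss
    have : gammaCoord (e ^ 2 * a) < gammaCoord (e ^ 2 * b) :=
      strictMonoOn_gammaCoord (mem_Ioi.2 (by positivity)) (mem_Ioi.2 (by positivity))
        (by gcongr)
    gcongr

theorem exists_gammaToGauss_eq {e : ℝ} (he : 0 < e) (y : ℝ) :
    ∃ t, 0 < t ∧ gammaToGauss e t = y := by
  have := gammaCoordInv_pos (e * y)
  refine ⟨gammaCoordInv (e * y) / e ^ 2, by positivity, ?_⟩
  rw [gammaToGauss, mul_div_cancel₀ _ (by positivity), gammaCoord_gammaCoordInv]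
  field_simp

theorem image_gammaToGauss_Ioi {e : ℝ} (he : 0 < e) : gammaToGauss e '' Ioi 0 = univ :=
  eq_univ_of_forall fun y => exists_gammaToGauss_eq he y

theorem image_gammaToGauss_Ioc {e m : ℝ} (he : 0 < e) (hm : 0 < m) :
    gammaToGauss e '' Ioc 0 m = Iic (gammaToGauss e m) := by
  have hmono := strictMonoOn_gammaToGauss he
  ext y
  constructor
  · rintro ⟨t, ht, rfl⟩
    exact hmono.monotoneOn ht.1 hm ht.2
  · intro hy
    obtain ⟨t, ht, rfl⟩ := exists_gammaToGauss_eq he y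
    exact ⟨t, ⟨ht, (hmono.le_iff_le ht hm).1 hy⟩, rfl⟩

/-- The gamma integrand of shape `e⁻²` is a multiple of the pulled back perturbed Gaussian. -/
theorem exists_pullback_perturbedGaussian {e : ℝ} (he : 0 < e) :
    ∃ D : ℝ, 0 < D ∧ ∀ t, 0 < t →
      |(e * t * gammaSlope (e ^ 2 * t))⁻¹| • perturbedGaussian e (gammaToGauss e t)
        = D * (Real.exp (-t) * t ^ ((e ^ 2)⁻¹ - 1)) := by
  -- The exponential collects the `t`-free part of `-φ(e² t)/e²`; the factor `e⁻¹` is what remains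
  -- of the Jacobian once the slope cancels the density.
  refine ⟨e⁻¹ * Real.exp ((e ^ 2)⁻¹ + (e ^ 2)⁻¹ * Real.log (e ^ 2)), by positivity,
    fun t ht => ?_⟩
  have h0 : 0 < e ^ 2 * t := by positivity
  have hs := gammaSlope_pos h0
  have hsq : -(gammaToGauss e t) ^ 2 / 2
      = ((e ^ 2)⁻¹ + (e ^ 2)⁻¹ * Real.log (e ^ 2)) + (-t) + Real.log t * (e ^ 2)⁻¹ := by
    rw [gammaToGauss, div_pow, gammaCoord_sq h0, gammaPhase,
      Real.log_mul (by positivity) ht.ne']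
    field_simp
    ring
  have hy : e * gammaToGauss e t = gammaCoord (e ^ 2 * t) := by
    rw [gammaToGauss]; field_simp
  rw [perturbedGaussian, hsq, hy, gammaDensity, gammaCoordInv_gammaCoord h0, Real.exp_add,
    Real.exp_add, ← Real.rpow_def_of_pos ht, Real.rpow_sub_one ht.ne', abs_of_pos (by positivity),
    smul_eq_mul]
  field_simp

theorem integrable_perturbedGaussian {e : ℝ} (he : 0 < e) : Integrable (perturbedGaussian e) := by
  obtain ⟨D, hD, h⟩ := exists_pullback_perturbedGaussian he
  rw [← integrableOn_univ, ← image_gammaToGauss_Ioi he,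
    integrableOn_image_iff_integrableOn_abs_deriv_smul measurableSet_Ioi
      (fun t ht => (hasDerivAt_gammaToGauss he ht).hasDerivWithinAt)
      (strictMonoOn_gammaToGauss he).injOn]
  exact IntegrableOn.congr_fun
    ((Real.GammaIntegral_convergent (s := (e ^ 2)⁻¹) (by positivity)).const_mul D)
    (fun t ht => (h t ht).symm) measurableSet_Ioi

/-- The rescaled quantile in the Gaussian coordinate. -/
noncomputable def gaussCoordQuantile (p e : ℝ) : ℝ :=
  gammaToGauss e (gammaQuantile p (e ^ 2)⁻¹)

/-- Both integrals pull back to gamma integrals with the same constant `D`, so the defining equation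
of the gamma quantile survives the change of variables. -/
theorem integral_perturbedGaussian_quantile {p e : ℝ} (h0 : 0 < p) (h1 : p < 1) (he : 0 < e) :
    ∫ y in Iic (gaussCoordQuantile p e), perturbedGaussian e y
      = p * ∫ y, perturbedGaussian e y := by
  have hx : 0 < (e ^ 2)⁻¹ := by positivity
  obtain ⟨hm, hq⟩ := gammaQuantile_spec h0 h1 hx
  obtain ⟨D, hD, h⟩ := exists_pullback_perturbedGaussian he
  have hall : ∫ y, perturbedGaussian e y = D * Real.Gamma (e ^ 2)⁻¹ := by
    rw [← setIntegral_univ, ← image_gammaToGauss_Ioi he,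
      integral_image_eq_integral_abs_deriv_smul measurableSet_Ioi
        (fun t ht => (hasDerivAt_gammaToGauss he ht).hasDerivWithinAt)
        (strictMonoOn_gammaToGauss he).injOn,
      setIntegral_congr_fun measurableSet_Ioi (fun t ht => h t ht), integral_const_mul,
      Real.Gamma_eq_integral hx]
  rw [hall, gaussCoordQuantile, ← image_gammaToGauss_Ioc he hm,
    integral_image_eq_integral_abs_deriv_smul measurableSet_Ioc
      (fun t ht => (hasDerivAt_gammaToGauss he ht.1).hasDerivWithinAt)
      ((strictMonoOn_gammaToGauss he).injOn.mono Ioc_subset_Ioi_self),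
    setIntegral_congr_fun measurableSet_Ioc (fun t ht => h t ht.1), integral_const_mul,
    ← intervalIntegral.integral_of_le hm.le, hq]
  ring

/-! ### Truncated Gaussian moments and the approximate quantile equation -/

theorem integrable_pow_mul_gaussian (k : ℕ) :
    Integrable fun y : ℝ => y ^ k * Real.exp (-y ^ 2 / 2) := by
  have := integrable_rpow_mul_exp_neg_mul_sq (b := 1 / 2) (by norm_num) (s := k)
    (by have : (0 : ℝ) ≤ k := k.cast_nonneg
        linarith)
  refine this.congr (Eventually.of_forall fun y => ?_)
  simp only [Real.rpow_natCast]
  congr 2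
  ring

/-- The centred truncated Gaussian moment `∫_{-∞}^Y y^k e^{-y²/2} - p ∫ y^k e^{-y²/2}`. -/
noncomputable def gaussMoment (p : ℝ) (k : ℕ) (Y : ℝ) : ℝ :=
  (∫ y in Iic Y, y ^ k * Real.exp (-y ^ 2 / 2)) - p * ∫ y, y ^ k * Real.exp (-y ^ 2 / 2)

/-- The polynomial approximation of the quantile equation in the Gaussian coordinate. -/
noncomputable def quantileEq (p : ℝ) (h : ℕ → ℝ) (K : ℕ) (u : ℝ × ℝ) : ℝ :=
  ∑ k ∈ Finset.range K, h k * u.1 ^ k * gaussMoment p k u.2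

/-- The quantile satisfies the approximate equation up to `O(e ^ K)`. -/
theorem quantileEq_isBigO {p : ℝ} (h0 : 0 < p) (h1 : p < 1) {K : ℕ} (hK : 1 ≤ K) {h : ℕ → ℝ}
    (hh : (fun y => gammaDensity y - ∑ k ∈ Finset.range K, h k * y ^ k) =O[𝓝 0] fun y => y ^ K) :
    (fun e => quantileEq p h K (e, gaussCoordQuantile p e)) =O[𝓝[>] 0] fun e => e ^ K := by
  obtain ⟨C, hC, hb⟩ := gammaDensity_taylor_bound hK hh
  set M := ∫ y : ℝ, |y| ^ K * Real.exp (-y ^ 2 / 2) with hM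
  have hMi : Integrable fun y : ℝ => |y| ^ K * Real.exp (-y ^ 2 / 2) := by
    refine (integrable_pow_mul_gaussian K).norm.congr (Eventually.of_forall fun y => ?_)
    simp
  refine Asymptotics.IsBigO.of_bound (C * M + p * (C * M)) ?_
  filter_upwards [self_mem_nhdsWithin] with e (he : 0 < e)
  set T : ℝ → ℝ := fun y => ∑ k ∈ Finset.range K, h k * e ^ k * (y ^ k * Real.exp (-y ^ 2 / 2))
    with hT
  have hTk : ∀ k ∈ Finset.range K,
      Integrable fun y : ℝ => h k * e ^ k * (y ^ k * Real.exp (-y ^ 2 / 2)) :=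
    fun k _ => (integrable_pow_mul_gaussian k).const_mul _
  have hTi : Integrable T := integrable_finsetSum _ hTk
  have hGi := integrable_perturbedGaussian he
  have hdiff : ∀ y, ‖T y - perturbedGaussian e y‖
      ≤ C * e ^ K * (|y| ^ K * Real.exp (-y ^ 2 / 2)) := fun y => by
    have h2 : T y - perturbedGaussian e y = -((gammaDensity (e * y) -
        ∑ k ∈ Finset.range K, h k * (e * y) ^ k) * Real.exp (-y ^ 2 / 2)) := by
      rw [hT, perturbedGaussian, sub_mul, Finset.sum_mul, neg_sub]
      congr 1
      · exact Finset.sum_congr rfl fun k _ => by ring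
      · ring
    rw [h2, norm_neg, norm_mul, Real.norm_eq_abs, Real.norm_of_nonneg (Real.exp_pos _).le]
    refine (mul_le_mul_of_nonneg_right (hb (e * y)) (Real.exp_pos _).le).trans (le_of_eq ?_)
    rw [abs_mul, abs_of_pos he]
    ring
  have hset : ∀ s : Set ℝ, ‖∫ y in s, (T y - perturbedGaussian e y)‖ ≤ C * e ^ K * M := by
    intro s
    have hint : Integrable fun y : ℝ => C * e ^ K * (|y| ^ K * Real.exp (-y ^ 2 / 2)) :=
      hMi.const_mul _
    refine (norm_integral_le_of_norm_le hint.integrableOn (Eventually.of_forall hdiff)).trans ?_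
    rw [hM, ← integral_const_mul]
    exact setIntegral_le_integral hint (Eventually.of_forall fun y => by
      simp only [Pi.zero_apply]; positivity)
  -- The exact density contributes zero by the quantile equation, so it may be subtracted and only
  -- the Taylor error is left.
  have heq : quantileEq p h K (e, gaussCoordQuantile p e)
      = (∫ y in Iic (gaussCoordQuantile p e), (T y - perturbedGaussian e y))
        - p * ∫ y in univ, (T y - perturbedGaussian e y) := by
    rw [setIntegral_univ, integral_sub hTi.integrableOn hGi.integrableOn, integral_sub hTi hGi,
      integral_perturbedGaussian_quantile h0 h1 he, integral_finsetSum _ hTk,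
      integral_finsetSum _ fun k hk => (hTk k hk).integrableOn]
    simp only [integral_const_mul]
    have : ∀ a b c : ℝ, (a - p * b) - p * (c - b) = a - p * c := fun a b c => by ring
    rw [this, Finset.mul_sum, ← Finset.sum_sub_distrib, quantileEq]
    refine Finset.sum_congr rfl fun k _ => ?_
    rw [gaussMoment]
    ring
  rw [heq, norm_pow, Real.norm_of_nonneg he.le]
  refine (norm_sub_le _ _).trans ?_
  rw [norm_mul, Real.norm_of_nonneg h0.le]
  have ha := hset (Iic (gaussCoordQuantile p e))
  have hb := mul_le_mul_of_nonneg_left (hset univ) h0.le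
  linarith

theorem hasDerivAt_gaussMoment (p : ℝ) (k : ℕ) (Y : ℝ) :
    HasDerivAt (gaussMoment p k) (Y ^ k * Real.exp (-Y ^ 2 / 2)) Y := by
  have hint := integrable_pow_mul_gaussian k
  have hc : Continuous fun y : ℝ => y ^ k * Real.exp (-y ^ 2 / 2) := by fun_prop
  have h1 : HasDerivAt (fun Y : ℝ => ∫ y in (0 : ℝ)..Y, y ^ k * Real.exp (-y ^ 2 / 2))
      (Y ^ k * Real.exp (-Y ^ 2 / 2)) Y :=
    intervalIntegral.integral_hasDerivAt_right (hc.intervalIntegrable _ _)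
      hc.stronglyMeasurable.stronglyMeasurableAtFilter hc.continuousAt
  refine (h1.add_const (gaussMoment p k 0)).congr_of_eventuallyEq (Eventually.of_forall fun y => ?_)
  have := intervalIntegral.integral_Iic_sub_Iic (a := 0) (b := y) hint.integrableOn
    hint.integrableOn
  simp only [gaussMoment, ← this]
  ring

theorem contDiff_gaussMoment (p : ℝ) (k : ℕ) : ContDiff ℝ ∞ (gaussMoment p k) := by
  refine contDiff_infty_iff_deriv.2
    ⟨fun Y => (hasDerivAt_gaussMoment p k Y).differentiableAt, ?_⟩
  have : deriv (gaussMoment p k) = fun Y => Y ^ k * Real.exp (-Y ^ 2 / 2) :=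
    funext fun Y => (hasDerivAt_gaussMoment p k Y).deriv
  rw [this]
  fun_prop

theorem strictMono_gaussMoment_zero (p : ℝ) : StrictMono (gaussMoment p 0) :=
  strictMono_of_deriv_pos fun Y => by
    rw [(hasDerivAt_gaussMoment p 0 Y).deriv]; positivity

/-- By reflection the mass below `-L` is the tail above `L`, namely `√(π/2) - (1 - 2p) √(π/2) = 2p
√(π/2)`. -/
theorem gaussMoment_zero_eq_zero {p : ℝ} (h0 : 0 < p) (h1 : p < 1) :
    gaussMoment p 0 (-gaussianUpperQuantile p) = 0 := by
  have hspec := gaussianUpperQuantile_spec h0 h1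
  have hint : Integrable fun y : ℝ => Real.exp (-y ^ 2 / 2) := by
    simpa using integrable_pow_mul_gaussian 0
  have heq : ∀ y : ℝ, Real.exp (-y ^ 2 / 2) = Real.exp (-(1 / 2) * y ^ 2) := fun y => by ring_nf
  have hall : ∫ y : ℝ, Real.exp (-y ^ 2 / 2) = 2 * √(Real.pi / 2) := by
    simp_rw [heq, integral_gaussian]
    rw [show Real.pi / (1 / 2) = 2 ^ 2 * (Real.pi / 2) by ring, Real.sqrt_mul (by positivity),
      Real.sqrt_sq (by norm_num)]
  have hhalf : ∫ y in Ioi (0 : ℝ), Real.exp (-y ^ 2 / 2) = √(Real.pi / 2) := by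
    simp_rw [heq, integral_gaussian_Ioi]
    rw [show Real.pi / (1 / 2) = 2 ^ 2 * (Real.pi / 2) by ring, Real.sqrt_mul (by positivity),
      Real.sqrt_sq (by norm_num)]
    ring
  have hsymm : ∫ y in Iic (-gaussianUpperQuantile p), Real.exp (-y ^ 2 / 2)
      = ∫ y in Ioi (gaussianUpperQuantile p), Real.exp (-y ^ 2 / 2) := by
    have := integral_comp_neg_Iic (-gaussianUpperQuantile p) (fun y => Real.exp (-y ^ 2 / 2))
    simpa using this
  have hsub := intervalIntegral.integral_interval_add_Ioi (a := 0) (b := gaussianUpperQuantile p)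
    hint.integrableOn hint.integrableOn
  simp only [gaussMoment, pow_zero, one_mul]
  rw [hsymm, hall]
  linarith

theorem gaussMoment_one (p Y : ℝ) : gaussMoment p 1 Y = -Real.exp (-Y ^ 2 / 2) := by
  have hd : ∀ y : ℝ, HasDerivAt (fun y : ℝ => -Real.exp (-y ^ 2 / 2))
      (y ^ 1 * Real.exp (-y ^ 2 / 2)) y := fun y => by
    have := (((hasDerivAt_pow 2 y).neg.div_const 2).exp).neg
    refine this.congr_deriv ?_
    simp
    ring
  have hi : Integrable fun y : ℝ => -Real.exp (-y ^ 2 / 2) := by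
    simpa using (integrable_pow_mul_gaussian 0).neg
  have hi' := integrable_pow_mul_gaussian 1
  rw [gaussMoment, integral_eq_zero_of_hasDerivAt_of_integrable hd hi' hi,
    integral_Iic_of_hasDerivAt_of_tendsto' (fun y _ => hd y) hi'.integrableOn
      (tendsto_zero_of_hasDerivAt_of_integrableOn_Iic (a := Y) (fun y _ => hd y) hi'.integrableOn
        hi.integrableOn)]
  ring

/-- Integration by parts: `(y² - 1) e^{-y²/2}` is the derivative of `-y e^{-y²/2}`, which vanishes
at both infinities. -/
theorem gaussMoment_two (p Y : ℝ) :
    gaussMoment p 2 Y = -(Y * Real.exp (-Y ^ 2 / 2)) + gaussMoment p 0 Y := by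
  have hd : ∀ y : ℝ, HasDerivAt (fun y : ℝ => -(y * Real.exp (-y ^ 2 / 2)))
      (y ^ 2 * Real.exp (-y ^ 2 / 2) - y ^ 0 * Real.exp (-y ^ 2 / 2)) y := fun y => by
    have := ((hasDerivAt_id y).mul ((hasDerivAt_pow 2 y).neg.div_const 2).exp).neg
    refine this.congr_deriv ?_
    simp
    ring
  have hi : Integrable fun y : ℝ => -(y * Real.exp (-y ^ 2 / 2)) := by
    simpa using (integrable_pow_mul_gaussian 1).neg
  have hi0 := integrable_pow_mul_gaussian 0
  have hi2 := integrable_pow_mul_gaussian 2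
  have hi' := hi2.sub hi0
  have e1 := integral_eq_zero_of_hasDerivAt_of_integrable hd hi' hi
  have e2 := integral_Iic_of_hasDerivAt_of_tendsto' (a := Y) (fun y _ => hd y) hi'.integrableOn
      (tendsto_zero_of_hasDerivAt_of_integrableOn_Iic (a := Y) (fun y _ => hd y) hi'.integrableOn
        hi.integrableOn)
  rw [integral_sub hi2 hi0] at e1
  rw [integral_sub hi2.integrableOn hi0.integrableOn] at e2
  rw [gaussMoment, gaussMoment]
  linear_combination e2 - p * e1

/-! ### Solving the approximate equation and expanding the quantile -/

theorem contDiff_quantileEq (p : ℝ) (h : ℕ → ℝ) (K : ℕ) : ContDiff ℝ ∞ (quantileEq p h K) := by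
  unfold quantileEq
  refine ContDiff.sum fun k _ => ?_
  exact (contDiff_const.mul (contDiff_fst.pow k)).mul ((contDiff_gaussMoment p k).comp contDiff_snd)

theorem quantileEq_zero_left (p : ℝ) {h : ℕ → ℝ} (hh : h 0 = 1) {K : ℕ} (hK : 1 ≤ K) (Y : ℝ) :
    quantileEq p h K (0, Y) = gaussMoment p 0 Y := by
  rw [quantileEq, Finset.sum_eq_single_of_mem 0 (Finset.mem_range.2 hK)]
  · simp [hh]
  · intro k _ hk
    simp [hk]

/-- On the line `e = 0` only the zeroth moment survives. Its nonzero derivative drives both the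
implicit function theorem and the error estimate. -/
theorem fderiv_quantileEq_inr (p : ℝ) {h : ℕ → ℝ} (hh : h 0 = 1) {K : ℕ} (hK : 1 ≤ K) (z d : ℝ) :
    fderiv ℝ (quantileEq p h K) (0, z) (0, d) = Real.exp (-z ^ 2 / 2) * d := by
  have hF : HasFDerivAt (quantileEq p h K) (fderiv ℝ (quantileEq p h K) (0, z)) (0, z) :=
    ((contDiff_quantileEq p h K).differentiable (by simp) _).hasFDerivAt
  have h1 : HasDerivAt (fun Y : ℝ => ((0 : ℝ), Y)) ((0 : ℝ), (1 : ℝ)) z :=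
    (hasDerivAt_const z (0 : ℝ)).prodMk (hasDerivAt_id z)
  have h2 := hF.comp_hasDerivAt z h1
  have h3 : (quantileEq p h K ∘ fun Y : ℝ => ((0 : ℝ), Y)) = gaussMoment p 0 :=
    funext fun Y => quantileEq_zero_left p hh hK Y
  rw [h3] at h2
  have h4 := h2.unique (hasDerivAt_gaussMoment p 0 z)
  have h5 : ((0 : ℝ), d) = d • ((0 : ℝ), (1 : ℝ)) := by simp
  rw [h5, map_smul, h4, smul_eq_mul]
  ring

/-- Near a base point at `e = 0`, solutions are controlled by the values of the equation. -/
theorem sub_isBigO_quantileEq_sub (p : ℝ) {h : ℕ → ℝ} (hh : h 0 = 1) {K : ℕ} (hK : 1 ≤ K) {z : ℝ}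
    {l : Filter ℝ} (hl : l ≤ 𝓝 0) {Y₁ Y₂ : ℝ → ℝ} (h₁ : Tendsto Y₁ l (𝓝 z))
    (h₂ : Tendsto Y₂ l (𝓝 z)) :
    (fun e => Y₁ e - Y₂ e) =O[l]
      fun e => quantileEq p h K (e, Y₁ e) - quantileEq p h K (e, Y₂ e) := by
  have hs : HasStrictFDerivAt (quantileEq p h K) (fderiv ℝ (quantileEq p h K) (0, z)) (0, z) :=
    (contDiff_quantileEq p h K).contDiffAt.hasStrictFDerivAt (by simp)
  have ht : Tendsto (fun e => ((e, Y₁ e), (e, Y₂ e))) l (𝓝 (((0 : ℝ), z), ((0 : ℝ), z))) :=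
    ((tendsto_id.mono_left hl).prodMk_nhds h₁).prodMk_nhds
      ((tendsto_id.mono_left hl).prodMk_nhds h₂)
  -- Both points have the same first coordinate, so strict differentiability sees only the `Y`
  -- direction, where the linear term dominates the error.
  have h3 := hs.isLittleO.comp_tendsto ht
  simp only [Function.comp_def, Prod.mk_sub_mk, sub_self, fderiv_quantileEq_inr p hh hK] at h3
  have hc : Real.exp (-z ^ 2 / 2) ≠ 0 := (Real.exp_pos _).ne'
  have h4 : (fun e => ((0 : ℝ), Y₁ e - Y₂ e)) =O[l]
      fun e => Real.exp (-z ^ 2 / 2) * (Y₁ e - Y₂ e) := by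
    have : (fun e => ((0 : ℝ), Y₁ e - Y₂ e)) =O[l] fun e => Y₁ e - Y₂ e :=
      Asymptotics.IsBigO.of_bound 1 (Eventually.of_forall fun e => by
        simp [Prod.norm_def])
    exact this.trans (Asymptotics.isBigO_self_const_mul hc _ _)
  have h5 := (h3.trans_isBigO h4).right_isBigO_add
  simp only [sub_add_cancel] at h5
  exact (Asymptotics.isBigO_self_const_mul hc _ _).trans h5

/-- The approximate quantile equation has a smooth solution. -/
theorem exists_smooth_solution (p : ℝ) {h : ℕ → ℝ} (hh : h 0 = 1) {K : ℕ} (hK : 1 ≤ K) {z : ℝ}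
    (hz : gaussMoment p 0 z = 0) :
    ∃ Y : ℝ → ℝ, ContDiffAt ℝ ∞ Y 0 ∧ Y 0 = z ∧ ∀ᶠ e in 𝓝 0, quantileEq p h K (e, Y e) = 0 := by
  have hF : ContDiffAt ℝ ∞ (quantileEq p h K) ((0 : ℝ), z) := (contDiff_quantileEq p h K).contDiffAt
  have hn : (∞ : ℕ∞ω) ≠ 0 := by simp
  have hinv : (fderiv ℝ (quantileEq p h K) ((0 : ℝ), z) ∘L .inr ℝ ℝ ℝ).IsInvertible := by
    refine ⟨ContinuousLinearEquiv.unitsEquivAut ℝ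
      (Units.mk0 (Real.exp (-z ^ 2 / 2)) (Real.exp_pos _).ne'), ?_⟩
    ext
    simp [fderiv_quantileEq_inr p hh hK]
  refine ⟨hF.implicitFunction hn hinv, hF.contDiffAt_implicitFunction hn hinv,
    hF.implicitFunction_apply_self hn hinv, ?_⟩
  filter_upwards [hF.eventually_apply_implicitFunction hn hinv] with e he
  rw [he, quantileEq_zero_left p hh hK, hz]

theorem gammaDensity_zero : gammaDensity 0 = 1 := by
  rw [gammaDensity, gammaCoordInv_zero, gammaSlope_one]

/-- Taylor coefficients of the density, normalised by its value at `0`. -/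
theorem exists_gammaDensity_taylor {K : ℕ} (hK : 1 ≤ K) :
    ∃ h : ℕ → ℝ, h 0 = 1 ∧
      (fun y => gammaDensity y - ∑ k ∈ Finset.range K, h k * y ^ k) =O[𝓝 0] fun y => y ^ K := by
  obtain ⟨h, hh⟩ := contDiffAt_gammaDensity.exists_taylor_isBigO K
  refine ⟨h, ?_, hh⟩
  obtain ⟨C, -, hb⟩ := gammaDensity_taylor_bound hK hh
  have := hb 0
  rw [Finset.sum_eq_single_of_mem 0 (Finset.mem_range.2 hK) (fun k _ hk => by simp [hk]),
    gammaDensity_zero, abs_zero, zero_pow (by omega : K ≠ 0), mul_zero, pow_zero, mul_one] at this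
  have h1 := abs_nonpos_iff.1 this
  linarith

/-- The case `K = 1` says that the zeroth moment at the quantile is `O(e)`; strict monotonicity then
gives the limit, which the local estimates presuppose. -/
theorem tendsto_gaussCoordQuantile {p : ℝ} (h0 : 0 < p) (h1 : p < 1) :
    Tendsto (gaussCoordQuantile p) (𝓝[>] 0) (𝓝 (-gaussianUpperQuantile p)) := by
  obtain ⟨h, hh0, hh⟩ := exists_gammaDensity_taylor le_rfl
  have hO := quantileEq_isBigO h0 h1 le_rfl hh
  simp only [quantileEq, Finset.sum_range_one, hh0, pow_zero, one_mul, pow_one] at hO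
  refine ((strictMono_gaussMoment_zero p).strictMonoOn univ).tendsto_of_tendsto_comp isOpen_univ
    (mem_univ _) (Eventually.of_forall fun _ => mem_univ _) ?_
  rw [gaussMoment_zero_eq_zero h0 h1]
  exact hO.trans_tendsto (tendsto_id.mono_left nhdsWithin_le_nhds)

/-- An approximate solution of the quantile equation approximates the quantile. -/
theorem gaussCoordQuantile_sub_isBigO {p : ℝ} (h0 : 0 < p) (h1 : p < 1) {K : ℕ} (hK : 1 ≤ K)
    {h : ℕ → ℝ} (hh0 : h 0 = 1)
    (hh : (fun y => gammaDensity y - ∑ k ∈ Finset.range K, h k * y ^ k) =O[𝓝 0] fun y => y ^ K)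
    {Y : ℝ → ℝ} (hY : Tendsto Y (𝓝[>] 0) (𝓝 (-gaussianUpperQuantile p)))
    (hYO : (fun e => quantileEq p h K (e, Y e)) =O[𝓝[>] 0] fun e => e ^ K) :
    (fun e => gaussCoordQuantile p e - Y e) =O[𝓝[>] 0] fun e => e ^ K :=
  (sub_isBigO_quantileEq_sub p hh0 hK nhdsWithin_le_nhds (tendsto_gaussCoordQuantile h0 h1)
    hY).trans ((quantileEq_isBigO h0 h1 hK hh).sub hYO)

/-- The rescaled gamma quantile in terms of the Gaussian coordinate. -/
theorem gammaQuantile_eq {p e : ℝ} (h0 : 0 < p) (h1 : p < 1) (he : 0 < e) :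
    e ^ 2 * gammaQuantile p (e ^ 2)⁻¹ = gammaCoordInv (e * gaussCoordQuantile p e) := by
  have hm := (gammaQuantile_spec h0 h1 (x := (e ^ 2)⁻¹) (by positivity)).1
  rw [gaussCoordQuantile, gammaToGauss, mul_div_cancel₀ _ he.ne',
    gammaCoordInv_gammaCoord (by positivity)]

/-- Transfer of approximations through the coordinate change. -/
theorem gammaQuantile_sub_isBigO {p : ℝ} (h0 : 0 < p) (h1 : p < 1) {K : ℕ} {Y : ℝ → ℝ} {z : ℝ}
    (hY : Tendsto Y (𝓝[>] 0) (𝓝 z))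
    (hYO : (fun e => gaussCoordQuantile p e - Y e) =O[𝓝[>] 0] fun e => e ^ K) :
    (fun e => e ^ 2 * gammaQuantile p (e ^ 2)⁻¹ - gammaCoordInv (e * Y e)) =O[𝓝[>] 0]
      fun e => e ^ (K + 1) := by
  have hs := (contDiffAt_gammaCoordInv.hasStrictDerivAt (by simp)).hasStrictFDerivAt
  have hid : Tendsto (fun e : ℝ => e) (𝓝[>] 0) (𝓝 0) := tendsto_id.mono_left nhdsWithin_le_nhds
  have ha : Tendsto (fun e => e * gaussCoordQuantile p e) (𝓝[>] 0) (𝓝 0) := by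
    simpa using hid.mul (tendsto_gaussCoordQuantile h0 h1)
  have hb : Tendsto (fun e => e * Y e) (𝓝[>] 0) (𝓝 0) := by
    simpa using hid.mul hY
  have hlip : (fun e => gammaCoordInv (e * gaussCoordQuantile p e) - gammaCoordInv (e * Y e))
      =O[𝓝[>] 0] fun e => e * gaussCoordQuantile p e - e * Y e :=
    hs.isBigO_sub.comp_tendsto (ha.prodMk_nhds hb)
  have h2 : (fun e => e * gaussCoordQuantile p e - e * Y e) =O[𝓝[>] 0] fun e => e ^ (K + 1) :=
    ((Asymptotics.isBigO_refl (fun e : ℝ => e) _).mul hYO).congr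
      (fun e => by ring) (fun e => by ring)
  refine (hlip.trans h2).congr' ?_ EventuallyEq.rfl
  filter_upwards [self_mem_nhdsWithin] with e (he : 0 < e)
  rw [gammaQuantile_eq h0 h1 he]

theorem exists_gammaQuantile_expansion_order {p : ℝ} (h0 : 0 < p) (h1 : p < 1) (K : ℕ) :
    ∃ c : ℕ → ℝ, (fun e => e ^ 2 * gammaQuantile p (e ^ 2)⁻¹
      - ∑ k ∈ Finset.range K, c k * e ^ k) =O[𝓝[>] 0] fun e => e ^ K := by
  -- One extra order makes the Taylor machinery available for `K = 0`; the surplus is truncated at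
  -- the end.
  have hK : 1 ≤ K + 1 := by omega
  obtain ⟨h, hh0, hh⟩ := exists_gammaDensity_taylor hK
  obtain ⟨Y, hYs, hYz, hYe⟩ := exists_smooth_solution p hh0 hK (gaussMoment_zero_eq_zero h0 h1)
  have hYt : Tendsto Y (𝓝[>] 0) (𝓝 (-gaussianUpperQuantile p)) := by
    rw [← hYz]; exact hYs.continuousAt.tendsto.mono_left nhdsWithin_le_nhds
  have hYO : (fun e => quantileEq p h (K + 1) (e, Y e)) =O[𝓝[>] 0] fun e => e ^ (K + 1) := by
    refine (Asymptotics.isBigO_zero _ _).congr' ?_ EventuallyEq.rfl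
    filter_upwards [nhdsWithin_le_nhds hYe] with e he using he.symm
  have hM := gammaQuantile_sub_isBigO h0 h1 hYt
    (gaussCoordQuantile_sub_isBigO h0 h1 hK hh0 hh hYt hYO)
  have hcomp : ContDiffAt ℝ ∞ (fun e => gammaCoordInv (e * Y e)) 0 := by
    refine ContDiffAt.comp (g := gammaCoordInv) (f := fun e => e * Y e) 0 ?_
      (contDiffAt_id.mul hYs)
    simpa using contDiffAt_gammaCoordInv
  obtain ⟨c, hc⟩ := hcomp.exists_taylor_isBigO (K + 1 + 1)
  refine ⟨c, isBigO_sub_sum_of_le nhdsWithin_le_nhds (by omega : K ≤ K + 1 + 1) ?_⟩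
  refine (hM.add (hc.mono nhdsWithin_le_nhds)).congr_left fun e => ?_
  ring

/-! ### The first coefficients -/

/-- The Gaussian coordinate of the quantile up to third order. -/
theorem gaussCoordQuantile_expansion {p : ℝ} (h0 : 0 < p) (h1 : p < 1) :
    (fun e => gaussCoordQuantile p e - (-gaussianUpperQuantile p - e / 3
      + -gaussianUpperQuantile p * e ^ 2 / 36)) =O[𝓝[>] 0] fun e => e ^ 3 := by
  set z := -gaussianUpperQuantile p with hz
  have hA : gaussMoment p 0 z = 0 := gaussMoment_zero_eq_zero h0 h1
  obtain ⟨h, hh0, hh⟩ := exists_gammaDensity_taylor (K := 3) (by norm_num)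
  set b : ℕ → ℝ := fun k => if k = 0 then 1 else if k = 1 then -1 / 3 else 1 / 12 with hb
  have hcoef := expansion_coeff_unique (b := h) (c := b) (hh.mono nhdsWithin_le_nhds)
    (gammaDensity_expansion.congr_left fun t => by
      simp [Finset.sum_range_succ, hb]; ring)
  have hc1 : h 1 = -1 / 3 := by rw [hcoef 1 (by norm_num)]; simp [hb]
  have hc2 : h 2 = 1 / 12 := by rw [hcoef 2 (by norm_num)]; simp [hb]
  set Y : ℝ → ℝ := fun e => z - e / 3 + z * e ^ 2 / 36 with hYdef
  have hYd : ∀ e, HasDerivAt Y (-1 / 3 + z * e / 18) e := fun e => by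
    have := ((hasDerivAt_const e z).sub ((hasDerivAt_id e).div_const 3)).add
      (((hasDerivAt_pow 2 e).const_mul z).div_const 36)
    refine this.congr_deriv ?_
    push_cast
    ring
  have hY0 : Y 0 = z := by simp [hYdef]
  have hYt : Tendsto Y (𝓝[>] 0) (𝓝 z) := by
    have := (hYd 0).continuousAt.tendsto
    rw [hY0] at this
    exact this.mono_left nhdsWithin_le_nhds
  refine gaussCoordQuantile_sub_isBigO h0 h1 (by norm_num) hh0 hh hYt ?_
  refine Asymptotics.IsBigO.mono ?_ nhdsWithin_le_nhds
  have hA0d : ∀ e, HasDerivAt (fun e => gaussMoment p 0 (Y e))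
      (Real.exp (-Y e ^ 2 / 2) * (-1 / 3 + z * e / 18)) e := fun e =>
    ((hasDerivAt_gaussMoment p 0 (Y e)).comp e (hYd e)).congr_deriv (by simp)
  have hEd : ∀ e, HasDerivAt (fun e => Real.exp (-Y e ^ 2 / 2))
      (-(Real.exp (-Y e ^ 2 / 2) * (Y e * (-1 / 3 + z * e / 18)))) e := fun e => by
    have := (((hYd e).pow 2).neg.div_const 2).exp
    refine this.congr_deriv ?_
    simp
    ring
  have hform : ∀ e, quantileEq p h 3 (e, Y e) = gaussMoment p 0 (Y e) * (1 + e ^ 2 / 12)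
      + Real.exp (-Y e ^ 2 / 2) * (e / 3 - e ^ 2 / 12 * Y e) := fun e => by
    simp only [quantileEq, Finset.sum_range_succ, Finset.sum_range_zero, hh0, hc1, hc2,
      gaussMoment_one, gaussMoment_two]
    ring
  refine Asymptotics.IsBigO.congr_left ?_ fun e => (hform e).symm
  -- The coefficients `-1/3` and `z/36` of `Y` cancel orders `0` and `1` of the factor of
  -- `exp(-Y²/2)` in the derivative; the listed polynomial is what remains after division by `e²`.
  -- The moment term is `O(e²)` since the moment vanishes at `e = 0`.
  refine isBigO_pow_succ_of_hasDerivAt (g' := fun e =>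
    gaussMoment p 0 (Y e) * (e / 6) + e ^ 2 * (Real.exp (-Y e ^ 2 / 2) *
      (1 / 54 - 5 / 108 * z ^ 2 + e * (5 / 216 * z + z ^ 3 / 216)
        - e ^ 2 * (1 / 324 + 5 / 972 * z ^ 2) + e ^ 3 * (z / 972 + z ^ 3 / 3888)
        - e ^ 4 * (5 / 46656 * z ^ 2) + e ^ 5 * (z ^ 3 / 279936)))) ?_
    (Eventually.of_forall fun e => ?_) ?_
  · simp [hY0, hA]
  · have hp1 : HasDerivAt (fun e : ℝ => 1 + e ^ 2 / 12) (e / 6) e :=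
      (((hasDerivAt_pow 2 e).div_const 12).const_add 1).congr_deriv (by push_cast; ring)
    have hp2 : HasDerivAt (fun e : ℝ => e / 3 - e ^ 2 / 12 * Y e)
        (1 / 3 - (e / 6 * Y e + e ^ 2 / 12 * (-1 / 3 + z * e / 18))) e :=
      (((hasDerivAt_id e).div_const 3).sub (((hasDerivAt_pow 2 e).div_const 12).mul
        (hYd e))).congr_deriv (by push_cast; ring)
    refine (((hA0d e).mul hp1).add ((hEd e).mul hp2)).congr_deriv ?_
    simp only [hYdef]
    ring
  · have hAO : (fun e => gaussMoment p 0 (Y e)) =O[𝓝 0] fun e => e := by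
      have := (hA0d 0).hasFDerivAt.isBigO_sub
      simpa [hY0, hA] using this
    have t1 : (fun e => gaussMoment p 0 (Y e) * (e / 6)) =O[𝓝 0] fun e => e ^ 2 :=
      (hAO.mul ((Asymptotics.isBigO_refl (fun e : ℝ => e) _).const_mul_left (1 / 6))).congr
        (fun e => by ring) (fun e => by ring)
    have hYc : Continuous Y := by fun_prop
    have t2 := (Asymptotics.isBigO_refl (fun e : ℝ => e ^ 2) (𝓝 0)).mul
      ((Continuous.tendsto (f := fun e : ℝ => Real.exp (-Y e ^ 2 / 2) *
        (1 / 54 - 5 / 108 * z ^ 2 + e * (5 / 216 * z + z ^ 3 / 216)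
        - e ^ 2 * (1 / 324 + 5 / 972 * z ^ 2) + e ^ 3 * (z / 972 + z ^ 3 / 3888)
        - e ^ 4 * (5 / 46656 * z ^ 2) + e ^ 5 * (z ^ 3 / 279936)))
        (by fun_prop) (0 : ℝ)).isBigO_one ℝ)
    simp only [mul_one] at t2
    exact t1.add t2

/-- The rescaled gamma quantile up to fourth order. -/
theorem gammaQuantile_expansion_four {p : ℝ} (h0 : 0 < p) (h1 : p < 1) {z : ℝ}
    (hz : z = -gaussianUpperQuantile p) :
    (fun e => e ^ 2 * gammaQuantile p (e ^ 2)⁻¹ - (1 + z * e + (z ^ 2 - 1) / 3 * e ^ 2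
      + (z ^ 3 - 7 * z) / 36 * e ^ 3)) =O[𝓝[>] 0] fun e => e ^ 4 := by
  have hexp := gaussCoordQuantile_expansion h0 h1
  rw [← hz] at hexp
  set Y : ℝ → ℝ := fun e => z - e / 3 + z * e ^ 2 / 36 with hYdef
  have hYc : Continuous Y := by fun_prop
  have hYt : Tendsto Y (𝓝[>] 0) (𝓝 z) :=
    (hYc.tendsto' 0 z (by simp [hYdef])).mono_left nhdsWithin_le_nhds
  have hM := gammaQuantile_sub_isBigO h0 h1 hYt hexp
  obtain ⟨c, hc⟩ := contDiffAt_gammaCoordInv.exists_taylor_isBigO 4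
  set b : ℕ → ℝ := fun k => if k = 0 then 1 else if k = 1 then 1 else if k = 2 then 1 / 3
    else 1 / 36 with hb
  have hcoef := expansion_coeff_unique (b := c) (c := b) (hc.mono nhdsWithin_le_nhds)
    (gammaCoordInv_expansion.congr_left fun t => by
      simp [Finset.sum_range_succ, hb]; ring)
  have hw : Tendsto (fun e => e * Y e) (𝓝[>] 0) (𝓝 0) :=
    ((by fun_prop : Continuous fun e => e * Y e).tendsto' 0 0 (by simp)).mono_left
      nhdsWithin_le_nhds
  have hρ := hc.comp_tendsto hw
  have hw4 : (fun e => (e * Y e) ^ 4) =O[𝓝[>] 0] fun e => e ^ 4 := by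
    have := ((Asymptotics.isBigO_refl (fun e : ℝ => e) (𝓝[>] 0)).mul (hYt.isBigO_one ℝ)).pow 4
    simpa using this
  have hρ4 := hρ.trans hw4
  -- The surplus of order at least `4` when `e Y` is substituted into the cubic for `v⁻¹`.
  have hq := (Asymptotics.isBigO_refl (fun e : ℝ => e ^ 4) (𝓝[>] 0)).mul
    (((Continuous.tendsto (f := fun e : ℝ => 1 / 27 - z ^ 2 / 108 + e * (z / 324 + z ^ 3 / 432)
      - e ^ 2 * (1 / 972 + 5 / 3888 * z ^ 2) + e ^ 3 * (z / 3888 + z ^ 3 / 15552)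
      - e ^ 4 * (z ^ 2 / 46656) + e ^ 5 * (z ^ 3 / 1679616)) (by fun_prop) (0 : ℝ)).isBigO_one
        ℝ).mono (nhdsWithin_le_nhds (s := Ioi 0)))
  simp only [mul_one] at hq
  refine ((hM.add hρ4).add hq).congr_left fun e => ?_
  simp only [Function.comp_def, Finset.sum_range_succ, Finset.sum_range_zero,
    hcoef 0 (by norm_num), hcoef 1 (by norm_num), hcoef 2 (by norm_num), hcoef 3 (by norm_num)]
  simp [hb, hYdef]
  ring

theorem exists_gammaQuantile_expansion {p : ℝ} (h0 : 0 < p) (h1 : p < 1) :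
    ∃ a : ℕ → ℝ, (∀ K : ℕ, (fun e => e ^ 2 * gammaQuantile p (e ^ 2)⁻¹
        - ∑ k ∈ Finset.range K, a k * e ^ k) =O[𝓝[>] 0] fun e => e ^ K) ∧
      a 0 = 1 ∧ a 1 = -gaussianUpperQuantile p ∧ a 2 = (gaussianUpperQuantile p ^ 2 - 1) / 3 ∧
      a 3 = gaussianUpperQuantile p * (7 - gaussianUpperQuantile p ^ 2) / 36 := by
  obtain ⟨a, ha⟩ := exists_expansion (exists_gammaQuantile_expansion_order h0 h1)
  set L := gaussianUpperQuantile p with hL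
  set b : ℕ → ℝ := fun k => if k = 0 then 1 else if k = 1 then -L else if k = 2 then
    (L ^ 2 - 1) / 3 else L * (7 - L ^ 2) / 36 with hb
  have b0 : b 0 = 1 := by simp [hb]
  have b1 : b 1 = -L := by simp [hb]
  have b2 : b 2 = (L ^ 2 - 1) / 3 := by simp [hb]
  have b3 : b 3 = L * (7 - L ^ 2) / 36 := by simp [hb]
  have hcoef := expansion_coeff_unique (b := a) (c := b) (ha 4)
    ((gammaQuantile_expansion_four h0 h1 rfl).congr_left fun t => by
      simp only [Finset.sum_range_succ, Finset.sum_range_zero, b0, b1, b2, b3, ← hL]; ring)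
  exact ⟨a, ha, (hcoef 0 (by norm_num)).trans b0, (hcoef 1 (by norm_num)).trans b1,
    (hcoef 2 (by norm_num)).trans b2, (hcoef 3 (by norm_num)).trans b3⟩

/-! ### Return to the variable `x` -/

/-- Expansions in `e = x ^ (-1/2)` as `e → 0+` are half-power expansions as `x → ∞`. -/
theorem hasHalfPowerExpansion_of_rescaled {f : ℝ → ℝ} {a : ℕ → ℝ}
    (h : ∀ K : ℕ, (fun e => e ^ 2 * f (e ^ 2)⁻¹
      - ∑ k ∈ Finset.range K, a k * e ^ k) =O[𝓝[>] 0] fun e => e ^ K) :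
    HasHalfPowerExpansion f (-2) fun n => a (n + 2).toNat := by
  intro N hN
  obtain ⟨J, rfl⟩ : ∃ J : ℕ, N = (J : ℤ) - 2 := ⟨(N + 2).toNat, by omega⟩
  have ht : Tendsto (fun x : ℝ => x ^ (-(1 / 2) : ℝ)) atTop (𝓝[>] 0) :=
    tendsto_nhdsWithin_iff.2 ⟨tendsto_rpow_neg_atTop (by norm_num), by
      filter_upwards [eventually_gt_atTop 0] with x hx using Real.rpow_pos_of_pos hx _⟩
  -- Multiplication by `x = e⁻²` removes the factor `e²` and shifts every index by `2`; order `J +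
  -- 1` in `e` matches `N = J - 2`.
  have h2 := (Asymptotics.isBigO_refl (fun x : ℝ => x) atTop).mul ((h (J + 1)).comp_tendsto ht)
  have hpow : ∀ x : ℝ, 0 < x → ∀ k : ℕ,
      x * (x ^ (-(1 / 2) : ℝ)) ^ k = x ^ (-(((k : ℝ) - 2) / 2)) := fun x hx k => by
    rw [← Real.rpow_natCast, ← Real.rpow_mul hx.le]
    nth_rewrite 1 [← Real.rpow_one x]
    rw [← Real.rpow_add hx]
    congr 1
    ring
  refine h2.congr' ?_ ?_
  · filter_upwards [eventually_gt_atTop 0] with x hx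
    have hsq : (x ^ (-(1 / 2) : ℝ)) ^ 2 = x⁻¹ := by
      rw [← Real.rpow_natCast, ← Real.rpow_mul hx.le, ← Real.rpow_neg_one]
      norm_num
    have hsum : ∑ n ∈ Finset.Icc (-2) ((J : ℤ) - 2), a (n + 2).toNat * x ^ (-((n : ℝ) / 2))
        = ∑ k ∈ Finset.range (J + 1), a k * (x * (x ^ (-(1 / 2) : ℝ)) ^ k) := by
      refine Finset.sum_nbij' (fun n => (n + 2).toNat) (fun k => (k : ℤ) - 2) ?_ ?_ ?_ ?_ ?_
      · intro n hn
        rw [Finset.mem_Icc] at hn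
        rw [Finset.mem_range]
        omega
      · intro k hk
        rw [Finset.mem_range] at hk
        rw [Finset.mem_Icc]
        omega
      · intro n hn
        rw [Finset.mem_Icc] at hn
        omega
      · intro k _
        omega
      · intro n hn
        rw [Finset.mem_Icc] at hn
        have : (((n + 2).toNat : ℕ) : ℝ) = (n : ℝ) + 2 := by
          have h3 : (((n + 2).toNat : ℕ) : ℤ) = n + 2 := by omega
          exact_mod_cast congrArg (Int.cast : ℤ → ℝ) h3
        rw [hpow x hx, this]
        congr 2
        ring
    simp only [Function.comp_def, hsq, inv_inv]
    rw [hsum, mul_sub, Finset.mul_sum, mul_inv_cancel_left₀ hx.ne']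
    congr 1
    exact Finset.sum_congr rfl fun k _ => by ring
  · filter_upwards [eventually_gt_atTop 0] with x hx
    simp only [Function.comp_def]
    rw [hpow x hx]
    congr 1
    push_cast
    ring

theorem mainTheorem7 (p : ℝ) (hp0 : 0 < p) (hp1 : p < 1) :
    ∃ τ : ℤ → ℝ,
      HasHalfPowerExpansion (fun x : ℝ => gammaQuantile p x) (-2) τ ∧
      τ (-2) = 1 ∧
      τ (-1) = -gaussianUpperQuantile p ∧
      τ 0 = (gaussianUpperQuantile p ^ 2 - 1) / 3 ∧
      τ 1 = gaussianUpperQuantile p * (7 - gaussianUpperQuantile p ^ 2) / 36 := by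
  obtain ⟨a, ha, a0, a1, a2, a3⟩ := exists_gammaQuantile_expansion hp0 hp1
  exact ⟨fun n => a (n + 2).toNat, hasHalfPowerExpansion_of_rescaled ha, a0, a1, a2, a3⟩
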